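/- **Setting.** Consider $n$ qubits (dimension $2^n$) and write $\|\cdot\|$ for the operator norm. Let $H_S$ and $S_1,\dots,S_J$ be Hermitian with $\|S_j\|\le 1$, let $\lambda\in\mathbb R$, and let $g_{j,\mu},\omega_\mu\in\mathbb C$ ($1\le j\le J$, $1\le \mu\le r$) with $\operatorname{Im}\omega_\mu>0$ be the parameters of the bath correlation functions $C_{j,k}(t)=\sum_\mu g_{j,\mu}^*g_{k,\mu}e^{i\omega_\mu t}$, $t>0$. Put $$G_{b,1}=2\sum_\mu\Big(\sum_j|g_{j,\mu}|\Big)^2\frac1{\operatorname{Im}\omega_\mu},\qquad G_{b,2}=\frac12\sum_\mu\Big(\sum_j|g_{j,\mu}|\Big)^2,\qquad \theta=\min_\mu\operatorname{Im}\omega_\mu .$$ Let $\widehat T_\mu=\sum_j g_{j,\mu}S_j$, $\widehat T_\mu(\tau)=e^{iH_S\tau}\widehat T_\mu e^{-iH_S\tau}$, $\mathcal L(F,G)\rho=F\rho G^\dagger+G\rho F^\dagger-\rho G^\dagger F-F^\dagger G\rho$, and $$\mathcal L_N(t)=\lambda^2\sum_\mu\int_0^t\mathcal L\big(\widehat T_\mu,\widehat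 T_\mu(-\tau)e^{i\omega_\mu\tau}\big)\,d\tau .$$ Let $\mathcal E_N(t,s)$, $0\le s\le t$, be the solution operator of $\partial_t\rho=-i[H_S,\rho]+\mathcal L_N(t)\rho$, and let $\rho_I(t)=e^{-iH_St}\rho_0e^{iH_St}$, where $\rho_0$ is a density matrix. **Method (NMNM).** Let $T=M\,\delta t$ with $\delta t>0$. For $k=0,\dots,M-1$ expand the recovery operator in the $n$-fold tensor products $\mathcal B_\ell=B_\ell\cdot B_\ell^\dagger$ of the 16 standard one-qubit operations: $$\mathcal E_Q^{(k)}=I-\delta t\,\mathcal L_N((k+1)\delta t)=\sum_\ell q_\ell^{(k)}\mathcal B_\ell,\qquad q_\ell^{(k)}\in\mathbb R .$$ The one-qubit operations are $[U]\rho=U\rho U^\dagger$ with $U$ equal to $I$, $\sigma^x$, $\sigma^y$, $\sigma^z$; $R_a=\frac{1}{\sqrt2}(1+i\sigma^a)$ for $a=x,y,z$; $\frac{1}{\sqrt2}(\sigma^y+\sigma^z)$, $\frac{1}{\sqrt2}(\sigma^z+\sigma^x)$, $\frac{1}{\sqrt2}(\sigma^x+\sigma^y)$; and, with $\pi=|0\rangle\langle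 0|$, $R_z^3R_x^3\pi R_xR_z$, $R_x\pi R_x^3$, $\pi$, $R_z^3R_x^3\pi R_x^3R_z$, $R_x\pi R_x^3R_z^2$, $\pi R_x^2$. Put $\gamma^{(k)}=\sum_\ell|q^{(k)}_\ell|$. A trajectory is a random sequence $\vec\ell=(\ell_0,\dots,\ell_{M-1})$ drawn with probability $\prod_k|q^{(k)}_{\ell_k}|/\gamma^{(k)}$. For a Hermitian observable $O$ its outcome is $$o=\Big(\prod_k\gamma^{(k)}\operatorname{sgn}q^{(k)}_{\ell_k}\Big)\operatorname{tr}\Big(O\,\mathcal B_{\ell_{M-1}}\mathcal E_N(M\delta t,(M-1)\delta t)\cdots\mathcal B_{\ell_0}\mathcal E_N(\delta t,0)\rho_0\Big).$$ **Theorem (sampling complexity).** For all real $K,b$ there are constants $c,C>0$, depending only on $K$ and $b$, and for every $n$ a constant $\kappa>0$, depending only on $K$, $b$ and $n$, such that the following holds for all data as above with $\|O\|\le b$ and all $\epsilon,\delta\in(0,1]$. Suppose that the coupling is weak or the time is short, in the sense that $$\lambda^2G_{b,1}\le K\|H_S\|\quad\text{or}\quad \lambda^2TG_{b,1}\le K,$$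 that $$\delta t\cdot\lambda^2\Big(T\|H_S\|G_{b,1}+\frac{G_{b,2}}{1-e^{-\theta}}\Big)\le c\,\epsilon,\qquad\text{and that}\qquad N_r\ge C\,\frac{\log(2/\delta)\,\exp(\kappa\,\lambda^2TG_{b,1})}{\epsilon^2}.$$ Then the outcomes $o^{(1)},\dots,o^{(N_r)}$ of $N_r$ independent trajectories satisfy, with probability at least $1-\delta$, $$\Big|\operatorname{tr}(O\rho_I(T))-\frac1{N_r}\sum_{m=1}^{N_r}o^{(m)}\Big|\le\epsilon .$$ -/

import Mathlib

open MeasureTheory ProbabilityTheory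
open scoped ComplexOrder Matrix Matrix.Norms.L2Operator

noncomputable section

/-! ### Open quantum systems of `n` qubits

Operators are complex matrices indexed by bit strings; `‖·‖` on them is the `ℓ²` operator norm. -/

/-- Operators on the `2 ^ n`-dimensional space of `n` qubits. -/
abbrev QMat (n : ℕ) := Matrix (Fin n → Fin 2) (Fin n → Fin 2) ℂ

/-- Continuous linear endomorphisms of a complex normed space. -/
abbrev BoundedEnd (E : Type) [NormedAddCommGroup E] [NormedSpace ℂ E] := E →L[ℂ] E

/-- Superoperators: linear maps on the (finite-dimensional) space of operators. -/
abbrev Superop (n : ℕ) := BoundedEnd (QMat n)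

/-- The data of the noise model: system Hamiltonian `H`, system coupling operators `S j`, the
parameters of the bath correlation functions
`C j k t = ∑ μ, conj (g j μ) * g k μ * exp (i * ω μ * t)` for `t > 0`,
and the coupling strength `lam`. -/
structure OpenSystem (n J r : ℕ) where
  H : QMat n
  S : Fin J → QMat n
  g : Fin J → Fin r → ℂ
  ω : Fin r → ℂ
  lam : ℝ

/-- A density matrix: positive semidefinite of unit trace. -/
def IsDensity {n : ℕ} (ρ : QMat n) : Prop := ρ.PosSemidef ∧ ρ.trace = 1

/-- The superoperator `X ↦ K * X * Kᴴ`. -/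
def conjOp {n : ℕ} (K : QMat n) : Superop n := ContinuousLinearMap.mulLeftRight ℂ (QMat n) K Kᴴ

/-- `𝓛(F, G) ρ = F ρ G† + G ρ F† - ρ G† F - F† G ρ`. -/
def lindbladForm {n : ℕ} (F G : QMat n) : Superop n :=
  ContinuousLinearMap.mulLeftRight ℂ (QMat n) F Gᴴ
    + ContinuousLinearMap.mulLeftRight ℂ (QMat n) G Fᴴ
    - ContinuousLinearMap.mulLeftRight ℂ (QMat n) 1 (Gᴴ * F)
    - ContinuousLinearMap.mulLeftRight ℂ (QMat n) (Fᴴ * G) 1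

namespace OpenSystem

variable {n J r : ℕ} (Q : OpenSystem n J r)

/-- `exp (-i t H)`. -/
def unitary (t : ℝ) : QMat n := NormedSpace.exp ((-(t : ℂ) * Complex.I) • Q.H)

/-- The noiseless evolution `ρ ↦ exp (-i t H) ρ exp (i t H)` over a time `t`. -/
def freeEvolution (t : ℝ) : Superop n :=
  ContinuousLinearMap.mulLeftRight ℂ (QMat n) (Q.unitary t) (Q.unitary (-t))

/-- The Heisenberg evolution `A(t) = exp (i t H) A exp (-i t H)`. -/
def heisenberg (A : QMat n) (t : ℝ) : QMat n := Q.unitary (-t) * A * Q.unitary t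

/-- The jump operators `T μ = ∑ j, g j μ • S j`. -/
def jump (μ : Fin r) : QMat n := ∑ j, Q.g j μ • Q.S j

/-- The integrand `𝓛(T μ, exp (i ω μ τ) • T μ (-τ))` of the noise generator. -/
def noiseKernel (μ : Fin r) (τ : ℝ) : Superop n :=
  lindbladForm (Q.jump μ)
    (Complex.exp (Complex.I * Q.ω μ * τ) • Q.heisenberg (Q.jump μ) (-τ))

/-- The time-dependent noise generator
`L(t) = lam ^ 2 ∑ μ, ∫₀ᵗ 𝓛(T μ, exp (i ω μ τ) T μ (-τ)) dτ`. -/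
def noiseGenerator (t : ℝ) : Superop n :=
  ((Q.lam : ℂ) ^ 2) • ∑ μ, ∫ τ in (0 : ℝ)..t, Q.noiseKernel μ τ

/-- `E t` (for `t ≥ s`) solves the time-local master equation `∂ₜ ρ = -i [H, ρ] + L(t) ρ` started
at time `s`, in Duhamel form. -/
def IsNoisyEvolutionFrom (s : ℝ) (E : ℝ → Superop n) : Prop :=
  ContinuousOn E (Set.Ici s) ∧
    ∀ t, s ≤ t → E t = Q.freeEvolution (t - s)
      + ∫ τ in s..t, Q.freeEvolution (t - τ) * Q.noiseGenerator τ * E τ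

end OpenSystem

/-- A linear differential equation with continuous coefficients in a Banach algebra has a global
solution (in integral form). -/
theorem exists_linear_volterra {A : Type*} [NormedRing A] [NormedAlgebra ℝ A] [CompleteSpace A]
    (a : ℝ → A) (ha : Continuous a) (s : ℝ) :
    ∃ Y : ℝ → A, ContinuousOn Y (Set.Ici s) ∧
      ∀ t, s ≤ t → Y t = 1 + ∫ τ in s..t, a τ * Y τ := by
  let y : ℕ → ℝ → A := fun k => Nat.rec (fun _ => 1) (fun _ f t => ∫ τ in s..t, a τ * f τ) k
  have y0 : y 0 = fun _ => 1 := rfl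
  have ys : ∀ k, y (k + 1) = fun t => ∫ τ in s..t, a τ * y k τ := fun _ => rfl
  have yc : ∀ k, Continuous (y k) := by
    intro k
    induction k with
    | zero => rw [y0]; exact continuous_const
    | succ k ih =>
      rw [ys]
      exact intervalIntegral.continuous_primitive
        (fun _ _ => (ha.mul ih).intervalIntegrable _ _) s
  have bound : ∀ R, ∃ C, 0 ≤ C ∧ ∀ t ∈ Set.Icc s R, ‖a t‖ ≤ C ∧
      ∀ k, ‖y k t‖ ≤ ‖(1 : A)‖ * (C * (t - s)) ^ k / k.factorial := by
    intro R
    obtain ⟨C, hC⟩ := (isCompact_Icc (a := s) (b := R)).exists_bound_of_continuousOn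
      ha.continuousOn
    refine ⟨max C 0, le_max_right _ _, fun t ht => ⟨(hC t ht).trans (le_max_left _ _), ?_⟩⟩
    intro k
    induction k generalizing t with
    | zero => simp [y0]
    | succ k ih =>
      rw [ys]
      set D := max C 0 with hD
      have hD0 : 0 ≤ D := le_max_right _ _
      have h1 : ‖∫ τ in s..t, a τ * y k τ‖
          ≤ ∫ τ in s..t, D * (‖(1 : A)‖ * (D * (τ - s)) ^ k / k.factorial) := by
        refine intervalIntegral.norm_integral_le_of_norm_le ht.1
          (Filter.Eventually.of_forall fun τ hτ => ?_)
          (Continuous.intervalIntegrable (by fun_prop) _ _)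
        have hτ' : τ ∈ Set.Icc s R := ⟨hτ.1.le, hτ.2.trans ht.2⟩
        exact (norm_mul_le _ _).trans
          (mul_le_mul ((hC τ hτ').trans (le_max_left _ _)) (ih τ hτ') (norm_nonneg _) hD0)
      refine h1.trans (le_of_eq ?_)
      have h2 : ∫ τ in s..t, (τ - s) ^ k = (t - s) ^ (k + 1) / (k + 1) := by
        rw [intervalIntegral.integral_comp_sub_right (fun x => x ^ k) s]
        simp [integral_pow]
      have h3 : (fun τ => D * (‖(1 : A)‖ * (D * (τ - s)) ^ k / k.factorial))
          = fun τ => (D ^ (k + 1) * ‖(1 : A)‖ / k.factorial) * (τ - s) ^ k := by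
        funext τ; rw [mul_pow]; ring
      rw [h3, intervalIntegral.integral_const_mul, h2, Nat.factorial_succ]
      push_cast
      have : (k.factorial : ℝ) ≠ 0 := by positivity
      rw [mul_pow]
      field_simp
  have ubound : ∀ R, ∃ C, 0 ≤ C ∧ Summable (fun k : ℕ => ‖(1 : A)‖ * C ^ k / k.factorial) ∧
      ∃ D, 0 ≤ D ∧ ∀ t ∈ Set.Icc s R, ‖a t‖ ≤ D ∧
      ∀ k, ‖y k t‖ ≤ ‖(1 : A)‖ * C ^ k / k.factorial := by
    intro R
    obtain ⟨C, hC0, hC⟩ := bound R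
    by_cases hR : s ≤ R
    · refine ⟨C * (R - s), mul_nonneg hC0 (by linarith), ?_, C, hC0, fun t ht =>
        ⟨(hC t ht).1, fun k => ((hC t ht).2 k).trans ?_⟩⟩
      · simpa [mul_div_assoc] using
          (Real.summable_pow_div_factorial (C * (R - s))).mul_left ‖(1 : A)‖
      · have h0 : 0 ≤ t - s := by linarith [ht.1]
        have h1 : t - s ≤ R - s := by linarith [ht.2]
        gcongr
    · refine ⟨0, le_rfl, ?_, 0, le_rfl, fun t ht => absurd (ht.1.trans ht.2) hR⟩
      simpa [mul_div_assoc] using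
          (Real.summable_pow_div_factorial (0 : ℝ)).mul_left ‖(1 : A)‖
  have hsum : ∀ t, s ≤ t → Summable fun k => y k t := by
    intro t ht
    obtain ⟨C, -, hC, D, -, hb⟩ := ubound t
    exact Summable.of_norm_bounded hC (hb t ⟨ht, le_rfl⟩).2
  have hcont : ∀ R, ContinuousOn (fun t => ∑' k, y k t) (Set.Icc s R) := by
    intro R
    obtain ⟨C, -, hC, D, -, hb⟩ := ubound R
    exact continuousOn_tsum (fun k => (yc k).continuousOn) hC (fun k t ht => (hb t ht).2 k)
  refine ⟨fun t => ∑' k, y k t, ?_, ?_⟩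
  · intro t ht
    have h1 := hcont (t + 1) t ⟨ht, by linarith⟩
    refine h1.mono_of_mem_nhdsWithin ?_
    rw [← Set.Ici_inter_Iic]
    exact Filter.inter_mem self_mem_nhdsWithin
      (mem_nhdsWithin_of_mem_nhds (Iic_mem_nhds (by linarith)))
  · intro t ht
    obtain ⟨C, hC0, hC, D, hD0, hb⟩ := ubound t
    have key : HasSum (fun k => ∫ τ in s..t, a τ * y k τ)
        (∫ τ in s..t, a τ * ∑' k, y k τ) := by
      refine intervalIntegral.hasSum_integral_of_dominated_convergence
        (fun k _ => D * (‖(1 : A)‖ * C ^ k / k.factorial)) ?_ ?_ ?_ ?_ ?_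
      · exact fun k => (ha.mul (yc k)).aestronglyMeasurable
      · refine fun k => Filter.Eventually.of_forall fun τ hτ => ?_
        rw [Set.uIoc_of_le ht] at hτ
        have hτ' : τ ∈ Set.Icc s t := ⟨hτ.1.le, hτ.2⟩
        exact (norm_mul_le _ _).trans
          (mul_le_mul (hb τ hτ').1 ((hb τ hτ').2 k) (norm_nonneg _) hD0)
      · exact Filter.Eventually.of_forall fun τ _ => hC.mul_left D
      · exact intervalIntegrable_const
      · refine Filter.Eventually.of_forall fun τ hτ => ?_
        rw [Set.uIoc_of_le ht] at hτ
        exact (hsum τ hτ.1.le).hasSum.mul_left (a τ)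
    have h := (hsum t ht).tsum_eq_zero_add
    simp only [y0, ys] at h
    rw [key.tsum_eq] at h
    exact h

namespace OpenSystem

variable {n J r : ℕ} (Q : OpenSystem n J r)

theorem unitary_add (s t : ℝ) : Q.unitary (s + t) = Q.unitary s * Q.unitary t := by
  unfold unitary
  let _ : NormedAlgebra ℚ (QMat n) := NormedAlgebra.restrictScalars ℚ ℂ (QMat n)
  rw [← NormedSpace.exp_add_of_commute, ← add_smul]
  · congr 2; push_cast; ring
  · exact ((Commute.refl Q.H).smul_left _).smul_right _

theorem continuous_unitary : Continuous Q.unitary := by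
  unfold unitary
  let _ : NormedAlgebra ℚ (QMat n) := NormedAlgebra.restrictScalars ℚ ℂ (QMat n)
  refine NormedSpace.exp_continuous.comp ?_
  fun_prop

theorem freeEvolution_add (s t : ℝ) :
    Q.freeEvolution (s + t) = Q.freeEvolution s * Q.freeEvolution t := by
  ext1 X
  have h : -(s + t) = -t + -s := by ring
  simp [freeEvolution, h, unitary_add, mul_assoc]

theorem continuous_freeEvolution : Continuous Q.freeEvolution := by
  have := Q.continuous_unitary
  unfold freeEvolution
  fun_prop

theorem continuous_noiseKernel (μ : Fin r) : Continuous (Q.noiseKernel μ) := by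
  have := Q.continuous_unitary
  unfold noiseKernel lindbladForm heisenberg
  fun_prop

theorem continuous_noiseGenerator : Continuous Q.noiseGenerator := by
  unfold noiseGenerator
  have h : ∀ μ, Continuous fun t => ∫ τ in (0 : ℝ)..t, Q.noiseKernel μ τ := fun μ =>
    intervalIntegral.continuous_primitive
      (fun _ _ => (Q.continuous_noiseKernel μ).intervalIntegrable _ _) 0
  fun_prop

theorem exists_noisyEvolutionFrom (s : ℝ) : ∃ E, Q.IsNoisyEvolutionFrom s E := by
  have hU := Q.continuous_freeEvolution
  have hL := Q.continuous_noiseGenerator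
  obtain ⟨Y, hYc, hY⟩ := exists_linear_volterra
    (fun τ => Q.freeEvolution (-τ) * Q.noiseGenerator τ * Q.freeEvolution τ)
    (by fun_prop) s
  refine ⟨fun t => Q.freeEvolution t * Y t * Q.freeEvolution (-s), ?_, fun t ht => ?_⟩
  · exact (hU.continuousOn.mul hYc).mul continuousOn_const
  · have hint : IntervalIntegrable (fun τ =>
        (Q.freeEvolution (-τ) * Q.noiseGenerator τ * Q.freeEvolution τ) * Y τ) volume s t := by
      refine ContinuousOn.intervalIntegrable ?_
      rw [Set.uIcc_of_le ht]
      exact ContinuousOn.mul (Continuous.continuousOn (by fun_prop)) (hYc.mono Set.Icc_subset_Ici_self)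
    let P : Superop n →L[ℝ] Superop n := (ContinuousLinearMap.mulLeftRight ℝ (Superop n)
      (Q.freeEvolution t) (Q.freeEvolution (-s)))
    have hP : ∀ X, P X = Q.freeEvolution t * X * Q.freeEvolution (-s) := fun X => rfl
    have hc := P.intervalIntegral_comp_comm hint
    have h0 : Q.freeEvolution (t - s) = Q.freeEvolution t * Q.freeEvolution (-s) := by
      rw [← freeEvolution_add, sub_eq_add_neg]
    change Q.freeEvolution t * Y t * Q.freeEvolution (-s) = _
    rw [hY t ht, mul_add, add_mul, mul_one, h0]
    congr 1
    rw [← hP, ← hc]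
    refine intervalIntegral.integral_congr fun τ _ => ?_
    simp only [hP]
    rw [sub_eq_add_neg, freeEvolution_add]
    simp only [mul_assoc]

/-- The noisy evolution `E_N(t, s)` for `0 ≤ s ≤ t`, i.e. the (unique) solution operator of the
time-local master equation from time `s` to time `t`. -/
def noisyEvolution (t s : ℝ) : Superop n := (Q.exists_noisyEvolutionFrom s).choose t

theorem noisyEvolution_spec (s : ℝ) :
    Q.IsNoisyEvolutionFrom s (fun t => Q.noisyEvolution t s) :=
  (Q.exists_noisyEvolutionFrom s).choose_spec

end OpenSystem

/-! ### The standard operation basis -/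

namespace StdBasis

/-- The Pauli matrix `σˣ`. -/
def σx : Matrix (Fin 2) (Fin 2) ℂ := !![0, 1; 1, 0]

/-- The Pauli matrix `σʸ`. -/
def σy : Matrix (Fin 2) (Fin 2) ℂ := !![0, -Complex.I; Complex.I, 0]

/-- The Pauli matrix `σᶻ`. -/
def σz : Matrix (Fin 2) (Fin 2) ℂ := !![1, 0; 0, -1]

/-- The projection `|0⟩⟨0|`. -/
def proj : Matrix (Fin 2) (Fin 2) ℂ := !![1, 0; 0, 0]

/-- `(1 + i σ) / √2`. -/
def rot (σ : Matrix (Fin 2) (Fin 2) ℂ) : Matrix (Fin 2) (Fin 2) ℂ :=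
  ((√2 : ℝ) : ℂ)⁻¹ • (1 + Complex.I • σ)

/-- `(σ + τ) / √2`. -/
def mix (σ τ : Matrix (Fin 2) (Fin 2) ℂ) : Matrix (Fin 2) (Fin 2) ℂ :=
  ((√2 : ℝ) : ℂ)⁻¹ • (σ + τ)

/-- The Kraus operators of the 16 standard one-qubit basis operations
`[I], [σˣ], [σʸ], [σᶻ], [R_x], [R_y], [R_z], [R_yz], [R_zx], [R_xy],
[π_x], [π_y], [π_z], [π_yx], [π_xz], [π_xy]`. -/
def kraus₁ : Fin 16 → Matrix (Fin 2) (Fin 2) ℂ :=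
  ![1, σx, σy, σz,
    rot σx, rot σy, rot σz, mix σy σz, mix σz σx, mix σx σy,
    rot σz ^ 3 * rot σx ^ 3 * proj * rot σx * rot σz,
    rot σx * proj * rot σx ^ 3,
    proj,
    rot σz ^ 3 * rot σx ^ 3 * proj * rot σx ^ 3 * rot σz,
    rot σx * proj * rot σx ^ 3 * rot σz ^ 2,
    proj * rot σx ^ 2]

end StdBasis

/-- The Kraus operator of the `n`-qubit basis operation with index `ℓ`: the tensor product of the
one-qubit Kraus operators with indices `ℓ i`. -/
def kraus {n : ℕ} (ℓ : Fin n → Fin 16) : QMat n :=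
  Matrix.of fun a b => ∏ i, StdBasis.kraus₁ (ℓ i) (a i) (b i)

/-- The standard basis operations `𝓑 ℓ = [B ℓ]` on `n` qubits. -/
def basisOp {n : ℕ} (ℓ : Fin n → Fin 16) : Superop n := conjOp (kraus ℓ)

/-- `q` are the real coefficients of `Φ` in the standard operation basis. -/
def IsQuasiProb {n : ℕ} (Φ : Superop n) (q : (Fin n → Fin 16) → ℝ) : Prop :=
  Φ = ∑ ℓ, (q ℓ : ℂ) • basisOp ℓ

/-- The coefficients of a Hermiticity-preserving `Φ` in the standard operation basis (they exist and
are unique, since the `16 ^ n` operations `basisOp ℓ` are linearly independent). -/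
def quasiProb {n : ℕ} (Φ : Superop n) : (Fin n → Fin 16) → ℝ := Classical.epsilon (IsQuasiProb Φ)

/-! ### Non-Markovian noise mitigation -/

namespace OpenSystem

variable {n J r : ℕ} (Q : OpenSystem n J r)

/-- `G₁ = 2 ∑ μ, (∑ j, |g j μ|)² / Im (ω μ)`. -/
def G₁ : ℝ := 2 * ∑ μ, (∑ j, ‖Q.g j μ‖) ^ 2 * (1 / (Q.ω μ).im)

/-- `G₂ = 1/2 ∑ μ, (∑ j, |g j μ|)²`. -/
def G₂ : ℝ := 1 / 2 * ∑ μ, (∑ j, ‖Q.g j μ‖) ^ 2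

/-- `θ = inf_μ Im (ω μ)`. -/
def θ : ℝ := ⨅ μ, (Q.ω μ).im

/-- The recovery operator `1 - δt L(t + δt)` for the interval `[t, t + δt]`. -/
def recovery (t δt : ℝ) : Superop n := 1 - (δt : ℂ) • Q.noiseGenerator (t + δt)

/-- The quasi-probabilities `q ℓ (k δt, δt)` of the recovery operator of step `k`. -/
def stepCoeff (δt : ℝ) (k : ℕ) : (Fin n → Fin 16) → ℝ := quasiProb (Q.recovery (k * δt) δt)

/-- The normalization constant `γ (k δt, δt) = ∑ ℓ, |q ℓ (k δt, δt)|`. -/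
def stepNorm (δt : ℝ) (k : ℕ) : ℝ := ∑ ℓ, |Q.stepCoeff δt k ℓ|

/-- The sampling probability `∏ k, |q (ℓ k)| / γ` of a sequence `ℓ` of basis operations. -/
def pathProb (δt : ℝ) {M : ℕ} (ℓ : Fin M → Fin n → Fin 16) : ℝ :=
  ∏ k : Fin M, |Q.stepCoeff δt k (ℓ k)| / Q.stepNorm δt k

/-- The sign `∏ k, sgn (q (ℓ k))` of a sequence `ℓ` of basis operations. -/
def pathSign (δt : ℝ) {M : ℕ} (ℓ : Fin M → Fin n → Fin 16) : ℝ :=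
  ∏ k : Fin M, Real.sign (Q.stepCoeff δt k (ℓ k))

/-- The total normalization constant `γ_tot`. -/
def totalNorm (δt : ℝ) (M : ℕ) : ℝ := ∏ k : Fin M, Q.stepNorm δt k

/-- The trajectory state
`𝓑 (ℓ (M-1)) E_N(M δt, (M-1) δt) ⋯ 𝓑 (ℓ 0) E_N(δt, 0) ρ₀`. -/
def trajectory (δt : ℝ) (ρ₀ : QMat n) : {M : ℕ} → (Fin M → Fin n → Fin 16) → QMat n
  | 0, _ => ρ₀
  | M + 1, ℓ => basisOp (ℓ (Fin.last M)) (Q.noisyEvolution ((M + 1 : ℕ) * δt) (M * δt)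
      (trajectory δt ρ₀ fun k : Fin M => ℓ k.castSucc))

/-- The outcome `γ_tot α_ℓ tr (O ρ_ℓ)` of the trajectory `ℓ` (the trace is real for Hermitian `O`
and `ρ₀`). -/
def outcome (δt : ℝ) (ρ₀ O : QMat n) {M : ℕ} (ℓ : Fin M → Fin n → Fin 16) : ℝ :=
  Q.totalNorm δt M * Q.pathSign δt ℓ * (O * Q.trajectory δt ρ₀ ℓ).trace.re

end OpenSystem

end

/-! Write Λ = λ²G₁, L = 2Λ and T = M δt. The error splits into a bias, the gap between the mean
outcome and the ideal value, and a sampling fluctuation.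

All estimates are made in the Heisenberg picture. `heisenbergDual` moves superoperators onto the
observable, where the operator norm is the natural one: the duals of the free evolution and of the
basis operations are contractions, and pairing an observable with a density matrix costs at most its
norm (`IsDensity.norm_trace_mul_le`). Hence the bias constants do not depend on the dimension.

Bias. Weights and signs cancel in the mean, so by linearity the expected outcome is that of the
alternating product of recovery operators and noisy steps (`sum_pathProb_mul_outcome`). In one step,
Duhamel's formula writes the noise as an integral of E*(τ) L*(τ) U*, while the recovery operator
subtracts δt times E* L* at the right end point. Comparing integrand and end value
(`norm_heisenbergDual_recovery_mul_sub_le`) leaves δt times terms of size L²δt and Lδt‖H‖, plus the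
increment of the noise generator over the step. Accumulated over M steps, the first two kinds
acquire a factor M, but the increments add up to at most 2Λ because the bath correlations decay. The
bias is therefore controlled by δt(TΛ² + TΛ‖H‖ + Λ). Either alternative in the coupling assumption
absorbs TΛ² into the other terms, and Λ is bounded through G₂ by 1 - exp(-θ) ≤ θ.

Fluctuation. The sixteen one-qubit operations form a basis, so the coefficients are unique and
depend linearly on the superoperator. The weight of a recovery operator is thus at most 1 + D δt L
with D depending only on n, and outcomes are bounded by ‖O‖ exp((2D + 4)ΛT) (`abs_outcome_le`).
Hoeffding's inequality concludes. -/

/-! ### One-qubit operations: partial isometries and linear independence. -/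

namespace StdBasis

/-- Scalars extracted from the one-qubit Kraus operators. -/
noncomputable def krausScale : Fin 16 → ℂ :=
  let s : ℂ := ((√2 : ℝ) : ℂ)⁻¹
  ![1, 1, 1, 1, s, s, s, s, s, s, 1 / 2, 1 / 2, 1, 1 / 2, 1 / 2, 1]

/-- The one-qubit Kraus operators up to the scalars `krausScale`. -/
noncomputable def krausInt : Fin 16 → Matrix (Fin 2) (Fin 2) ℂ :=
  ![!![1, 0; 0, 1],
    !![0, 1; 1, 0],
    !![0, -Complex.I; Complex.I, 0],
    !![1, 0; 0, -1],
    !![1, Complex.I; Complex.I, 1],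
    !![1, 1; -1, 1],
    !![1 + Complex.I, 0; 0, 1 - Complex.I],
    !![1, -Complex.I; Complex.I, -1],
    !![1, 1; 1, -1],
    !![0, 1 - Complex.I; 1 + Complex.I, 0],
    !![1, 1; 1, 1],
    !![-1, Complex.I; -Complex.I, -1],
    !![1, 0; 0, 0],
    !![-1, 1; -1, 1],
    !![-Complex.I, 1; 1, Complex.I],
    !![0, Complex.I; 0, 0]]

theorem inv_sqrt_two_mul_self : ((√2 : ℝ) : ℂ)⁻¹ * ((√2 : ℝ) : ℂ)⁻¹ = 1 / 2 := by
  rw [← mul_inv, ← Complex.ofReal_mul, Real.mul_self_sqrt (by norm_num)]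
  norm_num

theorem rot_sq {σ : Matrix (Fin 2) (Fin 2) ℂ} (h : σ * σ = 1) : rot σ ^ 2 = Complex.I • σ := by
  have : (1 + Complex.I • σ) * (1 + Complex.I • σ) = (2 * Complex.I) • σ := by
    simp only [mul_add, add_mul, one_mul, mul_one, smul_mul_smul_comm, h, Complex.I_mul_I]
    module
  rw [rot, pow_two, smul_mul_smul_comm, inv_sqrt_two_mul_self, this, smul_smul]
  congr 1; ring

theorem rot_cube {σ : Matrix (Fin 2) (Fin 2) ℂ} (h : σ * σ = 1) :
    rot σ ^ 3 = ((√2 : ℝ) : ℂ)⁻¹ • (Complex.I • σ - 1) := by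
  rw [pow_succ, rot_sq h, rot, mul_smul_comm]
  congr 1
  simp only [mul_add, mul_one, smul_mul_assoc, mul_smul_comm, smul_smul, h, Complex.I_mul_I]
  module

theorem σx_mul_self : σx * σx = 1 := by
  ext i j; fin_cases i <;> fin_cases j <;> simp [σx, Matrix.mul_apply]

theorem σz_mul_self : σz * σz = 1 := by
  ext i j; fin_cases i <;> fin_cases j <;> simp [σz, Matrix.mul_apply]

/-- With Gaussian-integer matrices split off, √2 enters only through a scalar s with s * s = 1/2,
and later identities become polynomial in s and the imaginary unit. -/
theorem kraus₁_eq (l : Fin 16) : kraus₁ l = krausScale l • krausInt l := by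
  have hs := inv_sqrt_two_mul_self
  have hI := Complex.I_mul_I
  fin_cases l
  all_goals
    simp only [kraus₁, krausScale, krausInt, rot_cube σx_mul_self, rot_cube σz_mul_self,
      rot_sq σx_mul_self, rot_sq σz_mul_self]
    simp only [rot, mix]
    generalize ((√2 : ℝ) : ℂ)⁻¹ = s at hs
    ext i j
    fin_cases i <;> fin_cases j
  all_goals
    simp [σx, σy, σz, proj, Matrix.mul_apply, Matrix.one_apply]
  all_goals grind

/-- Each operator is unitary, or a rank-one projection between two unitaries. The partial isometry
identity is preferred to a norm bound because it is polynomial and passes to tensor products factor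
by factor. -/
theorem kraus₁_mul_conjTranspose_mul (l : Fin 16) :
    kraus₁ l * (kraus₁ l)ᴴ * kraus₁ l = kraus₁ l := by
  have hs := inv_sqrt_two_mul_self
  have hc : (starRingEnd ℂ) ((√2 : ℝ) : ℂ)⁻¹ = ((√2 : ℝ) : ℂ)⁻¹ := by
    rw [← Complex.ofReal_inv, Complex.conj_ofReal]
  have hI := Complex.I_mul_I
  ext i j
  simp only [kraus₁_eq, Matrix.mul_apply, Fin.sum_univ_two, Matrix.conjTranspose_apply,
    Matrix.smul_apply, smul_eq_mul, star_mul', RCLike.star_def]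
  fin_cases l
  all_goals
    simp only [krausScale, krausInt]
    generalize ((√2 : ℝ) : ℂ)⁻¹ = s at hs hc
    fin_cases i <;> fin_cases j
  all_goals
    simp [hc, Complex.conj_ofNat]
  all_goals grind

/-- The sixteen one-qubit operations are linearly independent. -/
theorem kraus₁_linearIndependent (q : Fin 16 → ℂ)
    (h : ∀ a b c d, ∑ l, q l * (kraus₁ l a c * star (kraus₁ l b d)) = 0) : q = 0 := by
  have hs := inv_sqrt_two_mul_self
  have hc : (starRingEnd ℂ) ((√2 : ℝ) : ℂ)⁻¹ = ((√2 : ℝ) : ℂ)⁻¹ := by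
    rw [← Complex.ofReal_inv, Complex.conj_ofReal]
  -- The scales enter only through nonzero squared moduli; absorbed into the unknowns, they leave a
  -- linear system over the Gaussian integers.
  obtain ⟨p, hp⟩ : ∃ p : Fin 16 → ℂ, p = fun l => q l * (krausScale l * star (krausScale l)) :=
    ⟨_, rfl⟩
  replace h : ∀ a b c d, ∑ l, p l * (krausInt l a c * star (krausInt l b d)) = 0 := by
    intro a b c d
    rw [← h a b c d]
    refine Finset.sum_congr rfl fun l _ => ?_
    simp only [hp, kraus₁_eq, Matrix.smul_apply, smul_eq_mul, star_mul']
    ring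
  have hw : ∀ l, krausScale l * star (krausScale l) ≠ 0 := by
    intro l
    have h0 : krausScale l ≠ 0 := by
      fin_cases l <;> simp [krausScale]
    exact mul_ne_zero h0 (star_ne_zero.mpr h0)
  suffices hz : ∀ l, p l = 0 by
    funext l
    have := hz l
    rw [hp] at this
    exact (mul_eq_zero.mp this).resolve_right (hw l)
  have hI := Complex.I_mul_I
  clear hp hw hs hc q
  have h0 :
      p 0 + p 3 + p 4 + p 5 + 2 * p 6 + p 7 + p 8 + p 10 + p 11 + p 12 + p 13 + p 14 = 0 := by
    have := h 0 0 0 0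
    simp [Fin.sum_univ_succ, krausInt] at this
    grind
  have h1 :
      (-Complex.I) * p 4 + p 5 + Complex.I * p 7 + p 8 + p 10 + Complex.I * p 11 - p 13
      - Complex.I * p 14 = 0 := by
    have := h 0 0 0 1
    simp [Fin.sum_univ_succ, krausInt] at this
    grind
  have h2 :
      Complex.I * p 4 + p 5 - Complex.I * p 7 + p 8 + p 10 - Complex.I * p 11 - p 13
      + Complex.I * p 14 = 0 := by
    have := h 0 0 1 0
    simp [Fin.sum_univ_succ, krausInt] at this
    grind
  have h3 :
      p 1 + p 2 + p 4 + p 5 + p 7 + p 8 + 2 * p 9 + p 10 + p 11 + p 13 + p 14 + p 15 = 0 := by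
    have := h 0 0 1 1
    simp [Fin.sum_univ_succ, krausInt] at this
    grind
  have h4 :
      (-Complex.I) * p 4 - p 5 - Complex.I * p 7 + p 8 + p 10 - Complex.I * p 11 + p 13
      - Complex.I * p 14 = 0 := by
    have := h 0 1 0 0
    simp [Fin.sum_univ_succ, krausInt] at this
    grind
  have h5 :
      p 0 - p 3 + p 4 + p 5 + (2 * Complex.I) * p 6 - p 7 - p 8 + p 10 + p 11 - p 13
      - p 14 = 0 := by
    have := h 0 1 0 1
    simp [Fin.sum_univ_succ, krausInt] at this
    grind
  have h6 :
      p 1 - p 2 + p 4 - p 5 - p 7 + p 8 - (2 * Complex.I) * p 9 + p 10 - p 11 - p 13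
      + p 14 = 0 := by
    have := h 0 1 1 0
    simp [Fin.sum_univ_succ, krausInt] at this
    grind
  have h7 :
      Complex.I * p 4 + p 5 + Complex.I * p 7 - p 8 + p 10 - Complex.I * p 11 + p 13
      - Complex.I * p 14 = 0 := by
    have := h 0 1 1 1
    simp [Fin.sum_univ_succ, krausInt] at this
    grind
  have h8 :
      Complex.I * p 4 - p 5 + Complex.I * p 7 + p 8 + p 10 + Complex.I * p 11 + p 13
      + Complex.I * p 14 = 0 := by
    have := h 1 0 0 0
    simp [Fin.sum_univ_succ, krausInt] at this
    grind
  have h9 :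
      p 1 - p 2 + p 4 - p 5 - p 7 + p 8 + (2 * Complex.I) * p 9 + p 10 - p 11 - p 13
      + p 14 = 0 := by
    have := h 1 0 0 1
    simp [Fin.sum_univ_succ, krausInt] at this
    grind
  have h10 :
      p 0 - p 3 + p 4 + p 5 - (2 * Complex.I) * p 6 - p 7 - p 8 + p 10 + p 11 - p 13
      - p 14 = 0 := by
    have := h 1 0 1 0
    simp [Fin.sum_univ_succ, krausInt] at this
    grind
  have h11 :
      (-Complex.I) * p 4 + p 5 - Complex.I * p 7 - p 8 + p 10 + Complex.I * p 11 + p 13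
      + Complex.I * p 14 = 0 := by
    have := h 1 0 1 1
    simp [Fin.sum_univ_succ, krausInt] at this
    grind
  have h12 :
      p 1 + p 2 + p 4 + p 5 + p 7 + p 8 + 2 * p 9 + p 10 + p 11 + p 13 + p 14 = 0 := by
    have := h 1 1 0 0
    simp [Fin.sum_univ_succ, krausInt] at this
    grind
  have h13 :
      Complex.I * p 4 - p 5 - Complex.I * p 7 - p 8 + p 10 + Complex.I * p 11 - p 13
      - Complex.I * p 14 = 0 := by
    have := h 1 1 0 1
    simp [Fin.sum_univ_succ, krausInt] at this
    grind
  have h14 :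
      (-Complex.I) * p 4 - p 5 + Complex.I * p 7 - p 8 + p 10 - Complex.I * p 11 - p 13
      + Complex.I * p 14 = 0 := by
    have := h 1 1 1 0
    simp [Fin.sum_univ_succ, krausInt] at this
    grind
  have h15 :
      p 0 + p 3 + p 4 + p 5 + 2 * p 6 + p 7 + p 8 + p 10 + p 11 + p 13 + p 14 = 0 := by
    have := h 1 1 1 1
    simp [Fin.sum_univ_succ, krausInt] at this
    grind
  -- The combinations are rows of a left inverse of the system; the multiples of `hI` only reduce
  -- squares of the imaginary unit.
  intro l
  fin_cases l
  · change p 0 = 0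
    linear_combination
      (-1/4) * h1 - 1/4 * h2 - (1/4 * Complex.I) * h4 + ((1/4)
      + (1/4) * Complex.I) * h5 - 1/4 * h7 + ((1/4) * Complex.I) * h8 + ((1/4)
      - 1/4 * Complex.I) * h10 - 1/4 * h11 + ((1/4) * Complex.I) * h13
      - (1/4 * Complex.I) * h14 + (1/2) * h15 - p 4 * hI - p 6 * hI - p 11 * hI
  · change p 1 = 0
    linear_combination
      ((-1/4) - 1/4 * Complex.I) * h1 + ((-1/4) + (1/4) * Complex.I) * h2 + ((-1/4)
      - 1/4 * Complex.I) * h4 + ((1/4) - 1/4 * Complex.I) * h6 + ((-1/4)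
      + (1/4) * Complex.I) * h8 + ((1/4) + (1/4) * Complex.I) * h9 + (1/2) * h12
      - p 4 * hI - p 9 * hI - p 14 * hI
  · change p 2 = 0
    linear_combination
      ((1/4) * Complex.I) * h1 - (1/4 * Complex.I) * h2 - (1/4 * Complex.I) * h4
      + ((-1/4) - 1/4 * Complex.I) * h6 - 1/4 * h7 + ((1/4) * Complex.I) * h8 + ((-1/4)
      + (1/4) * Complex.I) * h9 - 1/4 * h11 + (1/2) * h12 + (1/4) * h13 + (1/4) * h14
      - p 7 * hI - p 9 * hI - p 11 * hI
  · change p 3 = 0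
    linear_combination
      ((-1/4) - 1/4 * Complex.I) * h4 + ((-1/4) + (1/4) * Complex.I) * h5 + ((-1/4)
      + (1/4) * Complex.I) * h8 + ((-1/4) - 1/4 * Complex.I) * h10 + ((1/4)
      - 1/4 * Complex.I) * h13 + ((1/4) + (1/4) * Complex.I) * h14 + (1/2) * h15
      - p 6 * hI - p 7 * hI - p 14 * hI
  · change p 4 = 0
    linear_combination
      ((1/8) * Complex.I) * h1 - (1/8 * Complex.I) * h2 + ((1/8) * Complex.I) * h4
      - (1/8 * Complex.I) * h7 - (1/8 * Complex.I) * h8 + ((1/8) * Complex.I) * h11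
      - (1/8 * Complex.I) * h13 + ((1/8) * Complex.I) * h14 + p 4 * hI
  · change p 5 = 0
    linear_combination
      (1/8) * h1 + (1/8) * h2 - 1/8 * h4 + (1/8) * h7 - 1/8 * h8 + (1/8) * h11
      - 1/8 * h13 - 1/8 * h14
  · change p 6 = 0
    linear_combination
      ((-1/4) * Complex.I) * h5 + ((1/4) * Complex.I) * h10 + p 6 * hI
  · change p 7 = 0
    linear_combination
      ((-1/8) * Complex.I) * h1 + ((1/8) * Complex.I) * h2 + ((1/8) * Complex.I) * h4
      - (1/8 * Complex.I) * h7 - (1/8 * Complex.I) * h8 + ((1/8) * Complex.I) * h11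
      + ((1/8) * Complex.I) * h13 - (1/8 * Complex.I) * h14 + p 7 * hI
  · change p 8 = 0
    linear_combination
      (1/8) * h1 + (1/8) * h2 + (1/8) * h4 - 1/8 * h7 + (1/8) * h8 - 1/8 * h11
      - 1/8 * h13 - 1/8 * h14
  · change p 9 = 0
    linear_combination
      ((1/4) * Complex.I) * h6 - (1/4 * Complex.I) * h9 + p 9 * hI
  · change p 10 = 0
    linear_combination
      (1/8) * h1 + (1/8) * h2 + (1/8) * h4 + (1/8) * h7 + (1/8) * h8 + (1/8) * h11
      + (1/8) * h13 + (1/8) * h14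
  · change p 11 = 0
    linear_combination
      ((-1/8) * Complex.I) * h1 + ((1/8) * Complex.I) * h2 + ((1/8) * Complex.I) * h4
      + ((1/8) * Complex.I) * h7 - (1/8 * Complex.I) * h8 - (1/8 * Complex.I) * h11
      - (1/8 * Complex.I) * h13 + ((1/8) * Complex.I) * h14 + p 11 * hI
  · change p 12 = 0
    linear_combination
      h0 - h15
  · change p 13 = 0
    linear_combination
      (-1/8) * h1 - 1/8 * h2 + (1/8) * h4 + (1/8) * h7 + (1/8) * h8 + (1/8) * h11
      - 1/8 * h13 - 1/8 * h14
  · change p 14 = 0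
    linear_combination
      ((1/8) * Complex.I) * h1 - (1/8 * Complex.I) * h2 + ((1/8) * Complex.I) * h4
      + ((1/8) * Complex.I) * h7 - (1/8 * Complex.I) * h8 - (1/8 * Complex.I) * h11
      + ((1/8) * Complex.I) * h13 - (1/8 * Complex.I) * h14 + p 14 * hI
  · change p 15 = 0
    linear_combination
      h3 - h12

end StdBasis

/-! ### Tensor products of one-qubit operations -/

/-- The tensor product of one-qubit operators. -/
noncomputable def qubitTensor {n : ℕ} (f : Fin n → Matrix (Fin 2) (Fin 2) ℂ) : QMat n :=
  Matrix.of fun a b => ∏ i, f i (a i) (b i)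

theorem sum_prod_eq_prod_sum {ι κ R : Type*} [Fintype ι] [DecidableEq ι] [Fintype κ]
    [CommSemiring R] (f : ι → κ → R) : ∑ p : ι → κ, ∏ i, f i (p i) = ∏ i, ∑ k, f i k := by
  rw [Finset.prod_univ_sum, Fintype.piFinset_univ]

theorem qubitTensor_mul {n : ℕ} (f g : Fin n → Matrix (Fin 2) (Fin 2) ℂ) :
    qubitTensor f * qubitTensor g = qubitTensor fun i => f i * g i := by
  ext a b
  simp only [qubitTensor, Matrix.mul_apply, Matrix.of_apply, ← Finset.prod_mul_distrib]
  exact sum_prod_eq_prod_sum fun i k => f i (a i) k * g i k (b i)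

theorem qubitTensor_conjTranspose {n : ℕ} (f : Fin n → Matrix (Fin 2) (Fin 2) ℂ) :
    (qubitTensor f)ᴴ = qubitTensor fun i => (f i)ᴴ := by
  ext a b
  simp [qubitTensor, Matrix.conjTranspose_apply]

theorem kraus_mul_conjTranspose_mul {n : ℕ} (ℓ : Fin n → Fin 16) :
    kraus ℓ * (kraus ℓ)ᴴ * kraus ℓ = kraus ℓ := by
  have h : kraus ℓ = qubitTensor fun i => StdBasis.kraus₁ (ℓ i) := rfl
  simp only [h, qubitTensor_conjTranspose, qubitTensor_mul, StdBasis.kraus₁_mul_conjTranspose_mul]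

/-- A partial isometry is a contraction. -/
theorem norm_le_one_of_mul_conjTranspose_mul {n : ℕ} {K : QMat n} (h : K * Kᴴ * K = K) :
    ‖K‖ ≤ 1 := by
  have h1 : ‖Kᴴ * K‖ = ‖K‖ * ‖K‖ := CStarRing.norm_star_mul_self
  have h2 : (Kᴴ * K)ᴴ * (Kᴴ * K) = Kᴴ * K := by
    rw [Matrix.conjTranspose_mul, Matrix.conjTranspose_conjTranspose]
    rw [mul_assoc, ← mul_assoc K, h]
  have h3 : ‖(Kᴴ * K)ᴴ * (Kᴴ * K)‖ = ‖Kᴴ * K‖ * ‖Kᴴ * K‖ := CStarRing.norm_star_mul_self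
  rw [h2, h1] at h3
  by_contra! hK
  have h4 : 1 < ‖K‖ * ‖K‖ := by nlinarith
  nlinarith

theorem norm_kraus_le_one {n : ℕ} (ℓ : Fin n → Fin 16) : ‖kraus ℓ‖ ≤ 1 :=
  norm_le_one_of_mul_conjTranspose_mul (kraus_mul_conjTranspose_mul ℓ)

/-! ### Coefficients in the standard operation basis -/

namespace StdBasis

/-- The matrix entries `⟨a|[K](|c⟩⟨d|)|b⟩` of the one-qubit operations, at `x = (a, b, c, d)`. -/
noncomputable def entry₁ (l : Fin 16) (x : Fin 2 × Fin 2 × Fin 2 × Fin 2) : ℂ :=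
  kraus₁ l x.1 x.2.2.1 * star (kraus₁ l x.2.1 x.2.2.2)

/-- An injective linear map between spaces of dimension 16 is bijective; `W x` is the preimage of
the unit vector at `x`. -/
theorem exists_entry₁_inverse : ∃ W : Fin 2 × Fin 2 × Fin 2 × Fin 2 → Fin 16 → ℂ,
    (∀ l l', ∑ x, entry₁ l x * W x l' = if l = l' then 1 else 0) ∧
    (∀ x x', ∑ l, W x l * entry₁ l x' = if x = x' then 1 else 0) := by
  let f : (Fin 16 → ℂ) →ₗ[ℂ] (Fin 2 × Fin 2 × Fin 2 × Fin 2 → ℂ) :=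
    { toFun := fun q x => ∑ l, q l * entry₁ l x
      map_add' := fun q r => by ext x; simp [add_mul, Finset.sum_add_distrib]
      map_smul' := fun c q => by ext x; simp [mul_assoc, Finset.mul_sum] }
  have hf : ∀ q x, f q x = ∑ l, q l * entry₁ l x := fun _ _ => rfl
  have hinj : Function.Injective f := by
    refine (injective_iff_map_eq_zero f).mpr fun q hq => kraus₁_linearIndependent q ?_
    intro a b c d
    exact congrFun hq (a, b, c, d)
  let e := LinearEquiv.ofInjectiveOfFinrankEq f hinj (by simp)
  have he : ∀ q, e q = f q := fun _ => rfl
  refine ⟨fun x => e.symm (Pi.single x 1), fun l l' => ?_, fun x x' => ?_⟩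
  · have h1 : e (Pi.single l 1) = entry₁ l := by
      ext x
      rw [he, hf]
      simp [Pi.single_apply]
    have h2 : entry₁ l = ∑ x, entry₁ l x • Pi.single x (1 : ℂ) := by
      ext x
      simp [Pi.single_apply]
    have h3 : e.symm (entry₁ l) = Pi.single l 1 := by rw [← h1, e.symm_apply_apply]
    rw [h2, map_sum] at h3
    have h4 := congrFun h3 l'
    simp only [map_smul, Finset.sum_apply, Pi.smul_apply, smul_eq_mul] at h4
    rw [h4]
    simp [Pi.single_apply, eq_comm]
  · rw [← hf, ← he, e.apply_symm_apply]
    simp [Pi.single_apply, eq_comm]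

/-- The inverse of the matrix `entry₁`. -/
noncomputable def dualEntry₁ : Fin 2 × Fin 2 × Fin 2 × Fin 2 → Fin 16 → ℂ :=
  exists_entry₁_inverse.choose

theorem sum_entry₁_mul_dualEntry₁ (l l' : Fin 16) :
    ∑ x, entry₁ l x * dualEntry₁ x l' = if l = l' then 1 else 0 :=
  exists_entry₁_inverse.choose_spec.1 l l'

theorem sum_dualEntry₁_mul_entry₁ (x x' : Fin 2 × Fin 2 × Fin 2 × Fin 2) :
    ∑ l, dualEntry₁ x l * entry₁ l x' = if x = x' then 1 else 0 :=
  exists_entry₁_inverse.choose_spec.2 x x'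

end StdBasis

/-- The matrix entry `⟨a|Φ(|c⟩⟨d|)|b⟩` of a superoperator, where `x i = (a i, b i, c i, d i)`. -/
noncomputable def superopEntry {n : ℕ} (x : Fin n → Fin 2 × Fin 2 × Fin 2 × Fin 2) (Φ : Superop n) :
    ℂ :=
  Φ (Matrix.single (fun i => (x i).2.2.1) (fun i => (x i).2.2.2) 1)
    (fun i => (x i).1) (fun i => (x i).2.1)

theorem superopEntry_basisOp {n : ℕ} (x : Fin n → Fin 2 × Fin 2 × Fin 2 × Fin 2)
    (ℓ : Fin n → Fin 16) : superopEntry x (basisOp ℓ) = ∏ i, StdBasis.entry₁ (ℓ i) (x i) := by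
  rw [superopEntry, basisOp, conjOp, ContinuousLinearMap.mulLeftRight_apply]
  simp [Matrix.mul_apply, Matrix.single_apply, StdBasis.entry₁, Finset.prod_mul_distrib, kraus,
    ite_and]

theorem superop_ext {n : ℕ} {Φ Ψ : Superop n} (h : ∀ x, superopEntry x Φ = superopEntry x Ψ) :
    Φ = Ψ := by
  ext1 X
  rw [Matrix.matrix_eq_sum_single X]
  simp only [map_sum]
  refine Finset.sum_congr rfl fun c _ => Finset.sum_congr rfl fun d _ => ?_
  have h1 : Matrix.single c d (X c d) = X c d • Matrix.single c d (1 : ℂ) := by simp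
  rw [h1, map_smul, map_smul]
  congr 1
  ext a b
  exact h fun i => (a i, b i, c i, d i)

/-- The coefficient of `Φ` at `basisOp ℓ`. -/
noncomputable def basisCoeff {n : ℕ} (ℓ : Fin n → Fin 16) : Superop n →ₗ[ℂ] ℂ where
  toFun Φ := ∑ x, (∏ i, StdBasis.dualEntry₁ (x i) (ℓ i)) * superopEntry x Φ
  map_add' Φ Ψ := by simp [superopEntry, mul_add, Finset.sum_add_distrib]
  map_smul' c Φ := by simp [superopEntry, mul_left_comm, Finset.mul_sum]

/-- The inverse of a tensor power is the tensor power of the inverse: the sum over multi-indices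
factorises over the qubits. -/
theorem basisCoeff_basisOp {n : ℕ} (ℓ ℓ' : Fin n → Fin 16) :
    basisCoeff ℓ (basisOp ℓ') = if ℓ' = ℓ then 1 else 0 := by
  change ∑ x, (∏ i, StdBasis.dualEntry₁ (x i) (ℓ i)) * superopEntry x (basisOp ℓ') = _
  simp only [superopEntry_basisOp, ← Finset.prod_mul_distrib]
  rw [sum_prod_eq_prod_sum fun i x => StdBasis.dualEntry₁ x (ℓ i) * StdBasis.entry₁ (ℓ' i) x]
  simp only [mul_comm (StdBasis.dualEntry₁ _ _), StdBasis.sum_entry₁_mul_dualEntry₁]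
  rw [Finset.prod_ite_zero]
  simp [funext_iff]

theorem sum_basisCoeff_smul_basisOp {n : ℕ} (Φ : Superop n) :
    ∑ ℓ, basisCoeff ℓ Φ • basisOp ℓ = Φ := by
  refine superop_ext fun y => ?_
  have h1 : superopEntry y (∑ ℓ, basisCoeff ℓ Φ • basisOp ℓ)
      = ∑ ℓ, basisCoeff ℓ Φ * ∏ i, StdBasis.entry₁ (ℓ i) (y i) := by
    simp only [← superopEntry_basisOp]
    simp [superopEntry, Matrix.sum_apply]
  have h2 : ∀ ℓ, basisCoeff ℓ Φ
      = ∑ x, (∏ i, StdBasis.dualEntry₁ (x i) (ℓ i)) * superopEntry x Φ := fun _ => rfl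
  rw [h1]
  simp only [h2, Finset.sum_mul]
  rw [Finset.sum_comm]
  have h3 : ∀ x : Fin n → Fin 2 × Fin 2 × Fin 2 × Fin 2,
      ∑ ℓ : Fin n → Fin 16, (∏ i, StdBasis.dualEntry₁ (x i) (ℓ i)) * superopEntry x Φ
        * ∏ i, StdBasis.entry₁ (ℓ i) (y i) = if x = y then superopEntry x Φ else 0 := by
    intro x
    have : ∀ ℓ : Fin n → Fin 16, (∏ i, StdBasis.dualEntry₁ (x i) (ℓ i)) * superopEntry x Φ
        * ∏ i, StdBasis.entry₁ (ℓ i) (y i)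
        = superopEntry x Φ *
          ∏ i, (StdBasis.dualEntry₁ (x i) (ℓ i) * StdBasis.entry₁ (ℓ i) (y i)) := by
      intro ℓ
      rw [Finset.prod_mul_distrib]; ring
    simp only [this]
    rw [← Finset.mul_sum,
      sum_prod_eq_prod_sum fun i l => StdBasis.dualEntry₁ (x i) l * StdBasis.entry₁ l (y i)]
    simp only [StdBasis.sum_dualEntry₁_mul_entry₁]
    rw [Finset.prod_ite_zero]
    simp [funext_iff]
  simp only [h3]
  simp

/-! ### Real coefficients and their total weight. -/

/-- Superoperators that commute with taking adjoints. -/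
def IsHermitianPreserving {n : ℕ} (Φ : Superop n) : Prop := ∀ X, Φ Xᴴ = (Φ X)ᴴ

theorem isHermitianPreserving_conjOp {n : ℕ} (K : QMat n) : IsHermitianPreserving (conjOp K) := by
  intro X
  simp [conjOp, mul_assoc]

/-- Conjugating the expansion of such a map gives a second expansion, with conjugated coefficients;
the two agree by uniqueness. -/
theorem IsHermitianPreserving.star_basisCoeff {n : ℕ} {Φ : Superop n}
    (h : IsHermitianPreserving Φ) (ℓ : Fin n → Fin 16) :
    star (basisCoeff ℓ Φ) = basisCoeff ℓ Φ := by
  have h1 : Φ = ∑ ℓ, star (basisCoeff ℓ Φ) • basisOp ℓ := by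
    ext1 X
    have h2 : Φ X = (Φ Xᴴ)ᴴ := by rw [h, Matrix.conjTranspose_conjTranspose]
    rw [h2]
    conv_lhs => rw [← sum_basisCoeff_smul_basisOp Φ]
    simp only [sum_apply, smul_apply,
      Matrix.conjTranspose_sum, Matrix.conjTranspose_smul]
    refine Finset.sum_congr rfl fun ℓ _ => ?_
    rw [basisOp, isHermitianPreserving_conjOp, Matrix.conjTranspose_conjTranspose]
  conv_rhs => rw [h1]
  simp [basisCoeff_basisOp]

/-- The `Classical.epsilon` choice has the required property once some real expansion exists; the
dual functionals supply one. -/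
theorem IsHermitianPreserving.isQuasiProb_quasiProb {n : ℕ} {Φ : Superop n}
    (h : IsHermitianPreserving Φ) : IsQuasiProb Φ (quasiProb Φ) := by
  refine Classical.epsilon_spec (p := IsQuasiProb Φ) ⟨fun ℓ => (basisCoeff ℓ Φ).re, ?_⟩
  have h1 : ∀ ℓ, (((basisCoeff ℓ Φ).re : ℝ) : ℂ) = basisCoeff ℓ Φ := fun ℓ =>
    Complex.conj_eq_iff_re.mp (h.star_basisCoeff ℓ)
  simp only [IsQuasiProb, h1, sum_basisCoeff_smul_basisOp]

theorem IsHermitianPreserving.quasiProb_eq {n : ℕ} {Φ : Superop n}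
    (h : IsHermitianPreserving Φ) (ℓ : Fin n → Fin 16) :
    (quasiProb Φ ℓ : ℂ) = basisCoeff ℓ Φ := by
  conv_rhs => rw [h.isQuasiProb_quasiProb]
  simp [basisCoeff_basisOp]

theorem basisOp_zero {n : ℕ} : basisOp (0 : Fin n → Fin 16) = 1 := by
  have h : kraus (0 : Fin n → Fin 16) = 1 := by
    ext a b
    simp only [kraus, Matrix.of_apply, Pi.zero_apply, StdBasis.kraus₁, Matrix.cons_val_zero,
      Matrix.one_apply]
    rw [Finset.prod_ite_zero]
    simp [funext_iff]
  ext1 X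
  simp [basisOp, conjOp, h]

/-- Linear functionals on a finite-dimensional space are bounded. This constant is the only source
of the dependence of κ on `n`. -/
theorem exists_sum_norm_basisCoeff_le (n : ℕ) :
    ∃ D : ℝ, 0 ≤ D ∧ ∀ Φ : Superop n, ∑ ℓ, ‖basisCoeff ℓ Φ‖ ≤ D * ‖Φ‖ := by
  refine ⟨∑ ℓ : Fin n → Fin 16, ‖LinearMap.toContinuousLinearMap (basisCoeff ℓ)‖,
    Finset.sum_nonneg fun _ _ => ContinuousLinearMap.opNorm_nonneg _, fun Φ => ?_⟩
  rw [Finset.sum_mul]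
  exact Finset.sum_le_sum fun ℓ _ => (LinearMap.toContinuousLinearMap (basisCoeff ℓ)).le_opNorm Φ

/-- The quasi-probabilities of a perturbation of the identity have total weight close to `1`. -/
theorem exists_sum_abs_quasiProb_one_sub_le (n : ℕ) :
    ∃ D : ℝ, 0 ≤ D ∧ ∀ Φ : Superop n, IsHermitianPreserving (1 - Φ) →
      ∑ ℓ, |quasiProb (1 - Φ) ℓ| ≤ 1 + D * ‖Φ‖ := by
  obtain ⟨D, hD0, hD⟩ := exists_sum_norm_basisCoeff_le n
  refine ⟨D, hD0, fun Φ h => ?_⟩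
  have h1 : ∀ ℓ, |quasiProb (1 - Φ) ℓ| ≤ (if 0 = ℓ then 1 else 0) + ‖basisCoeff ℓ Φ‖ := by
    intro ℓ
    rw [← Real.norm_eq_abs, ← Complex.norm_real, h.quasiProb_eq, map_sub]
    refine (norm_sub_le _ _).trans ?_
    -- The identity is itself the basis operation of index 0, so it contributes weight exactly 1,
    -- not a multiple of `D`.
    rw [← basisOp_zero, basisCoeff_basisOp]
    split_ifs <;> simp
  refine (Finset.sum_le_sum fun ℓ _ => h1 ℓ).trans ?_
  rw [Finset.sum_add_distrib]
  simpa using hD Φ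

/-! ### The Heisenberg picture -/

theorem trace_mul_single_one {n : ℕ} (Z : QMat n) (c d : Fin n → Fin 2) :
    (Z * Matrix.single c d (1 : ℂ)).trace = Z d c := by
  simp [Matrix.trace, Matrix.mul_apply, Matrix.single_apply, ite_and]

/-- The adjoint of a superoperator for the pairing `tr (X * Y)`. -/
noncomputable def heisenbergDual {n : ℕ} : Superop n →L[ℂ] Superop n :=
  LinearMap.toContinuousLinearMap
    { toFun := fun Φ => LinearMap.toContinuousLinearMap
        { toFun := fun X => Matrix.of fun a b => (X * Φ (Matrix.single b a 1)).trace
          map_add' := fun X Y => by ext a b; simp [add_mul]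
          map_smul' := fun c X => by ext a b; simp }
      map_add' := fun Φ Ψ => by ext X a b; simp [mul_add]
      map_smul' := fun c Φ => by ext X a b; simp }

theorem heisenbergDual_apply_apply {n : ℕ} (Φ : Superop n) (X : QMat n) (a b : Fin n → Fin 2) :
    heisenbergDual Φ X a b = (X * Φ (Matrix.single b a 1)).trace := rfl

theorem trace_heisenbergDual_mul {n : ℕ} (Φ : Superop n) (X Y : QMat n) :
    (heisenbergDual Φ X * Y).trace = (X * Φ Y).trace := by
  rw [Matrix.matrix_eq_sum_single Y]
  simp only [map_sum, Finset.mul_sum, Matrix.trace_sum]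
  refine Finset.sum_congr rfl fun c _ => Finset.sum_congr rfl fun d _ => ?_
  have h1 : Matrix.single c d (Y c d) = Y c d • Matrix.single c d (1 : ℂ) := by simp
  rw [h1, map_smul, mul_smul_comm, mul_smul_comm, Matrix.trace_smul, Matrix.trace_smul,
    trace_mul_single_one, heisenbergDual_apply_apply]

/-- Nondegeneracy of the trace pairing: every adjoint below is identified this way. -/
theorem heisenbergDual_eq {n : ℕ} {Φ Ψ : Superop n}
    (h : ∀ X Y, (Ψ X * Y).trace = (X * Φ Y).trace) : heisenbergDual Φ = Ψ := by
  ext1 X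
  refine Matrix.ext_iff_trace_mul_right.mpr fun Y => ?_
  rw [trace_heisenbergDual_mul, h]

theorem heisenbergDual_mul {n : ℕ} (Φ Ψ : Superop n) :
    heisenbergDual (Φ * Ψ) = heisenbergDual Ψ * heisenbergDual Φ :=
  heisenbergDual_eq fun X Y => by
    change (heisenbergDual Ψ (heisenbergDual Φ X) * Y).trace = (X * Φ (Ψ Y)).trace
    rw [trace_heisenbergDual_mul, trace_heisenbergDual_mul]

theorem heisenbergDual_one {n : ℕ} : heisenbergDual (1 : Superop n) = 1 :=
  heisenbergDual_eq fun _ _ => rfl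

theorem heisenbergDual_mulLeftRight {n : ℕ} (A B : QMat n) :
    heisenbergDual (ContinuousLinearMap.mulLeftRight ℂ (QMat n) A B)
      = ContinuousLinearMap.mulLeftRight ℂ (QMat n) B A :=
  heisenbergDual_eq fun X Y => by
    simp only [ContinuousLinearMap.mulLeftRight_apply]
    rw [mul_assoc B, mul_assoc B, Matrix.trace_mul_comm B]
    simp only [mul_assoc]

theorem norm_mulLeftRight_le {n : ℕ} (A B : QMat n) :
    ‖ContinuousLinearMap.mulLeftRight ℂ (QMat n) A B‖ ≤ ‖A‖ * ‖B‖ :=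
  ContinuousLinearMap.opNorm_mulLeftRight_apply_apply_le ℂ (QMat n) A B

theorem norm_heisenbergDual_basisOp_le {n : ℕ} (ℓ : Fin n → Fin 16) :
    ‖heisenbergDual (basisOp ℓ)‖ ≤ 1 := by
  rw [basisOp, conjOp, heisenbergDual_mulLeftRight]
  refine (norm_mulLeftRight_le _ _).trans ?_
  rw [Matrix.l2_opNorm_conjTranspose]
  exact mul_le_one₀ (norm_kraus_le_one ℓ) (norm_nonneg _) (norm_kraus_le_one ℓ)

/-- The bound on the superoperator itself serves the quasi-probability weights; its dual version,
next, serves the bias and the trajectories. -/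
theorem norm_lindbladForm_le {n : ℕ} (F G : QMat n) : ‖lindbladForm F G‖ ≤ 4 * (‖F‖ * ‖G‖) := by
  have h1 : ‖(1 : QMat n)‖ = 1 := norm_one
  have h2 := norm_mulLeftRight_le F Gᴴ
  have h3 := norm_mulLeftRight_le G Fᴴ
  have h4 := norm_mulLeftRight_le 1 (Gᴴ * F)
  have h5 := norm_mulLeftRight_le (Fᴴ * G) 1
  have h6 := norm_mul_le Gᴴ F
  have h7 := norm_mul_le Fᴴ G
  rw [Matrix.l2_opNorm_conjTranspose] at h2 h3 h6 h7
  rw [h1] at h4 h5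
  unfold lindbladForm
  refine (norm_sub_le _ _).trans ?_
  refine (add_le_add_left (norm_sub_le _ _) _).trans ?_
  refine (add_le_add_left (add_le_add_left (norm_add_le _ _) _) _).trans ?_
  nlinarith

theorem norm_heisenbergDual_lindbladForm_le {n : ℕ} (F G : QMat n) :
    ‖heisenbergDual (lindbladForm F G)‖ ≤ 4 * (‖F‖ * ‖G‖) := by
  have h1 : ‖(1 : QMat n)‖ = 1 := norm_one
  have h2 := norm_mulLeftRight_le Gᴴ F
  have h3 := norm_mulLeftRight_le Fᴴ G
  have h4 := norm_mulLeftRight_le (Gᴴ * F) 1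
  have h5 := norm_mulLeftRight_le 1 (Fᴴ * G)
  have h6 := norm_mul_le Gᴴ F
  have h7 := norm_mul_le Fᴴ G
  rw [Matrix.l2_opNorm_conjTranspose] at h2 h3 h6 h7
  rw [h1] at h4 h5
  unfold lindbladForm
  simp only [map_add, map_sub, heisenbergDual_mulLeftRight]
  refine (norm_sub_le _ _).trans ?_
  refine (add_le_add_left (norm_sub_le _ _) _).trans ?_
  refine (add_le_add_left (add_le_add_left (norm_add_le _ _) _) _).trans ?_
  nlinarith

/-- Taking adjoints exchanges the two jump terms and exchanges the two anticommutator-type terms. -/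
theorem isHermitianPreserving_lindbladForm {n : ℕ} (F G : QMat n) :
    IsHermitianPreserving (lindbladForm F G) := by
  intro X
  simp only [lindbladForm, add_apply, sub_apply,
    ContinuousLinearMap.mulLeftRight_apply, Matrix.conjTranspose_add, Matrix.conjTranspose_sub,
    Matrix.conjTranspose_mul, Matrix.conjTranspose_conjTranspose, one_mul, mul_one, mul_assoc]
  abel

theorem conjTranspose_intervalIntegral {n : ℕ} {f : ℝ → QMat n} (hf : Continuous f) (s t : ℝ) :
    (∫ τ in s..t, f τ)ᴴ = ∫ τ in s..t, (f τ)ᴴ :=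
  (((starL' ℝ : QMat n ≃L[ℝ] QMat n).toContinuousLinearMap).intervalIntegral_comp_comm
    (hf.intervalIntegrable s t)).symm

theorem isHermitianPreserving_intervalIntegral {n : ℕ} {f : ℝ → Superop n} (hf : Continuous f)
    (h : ∀ τ, IsHermitianPreserving (f τ)) (s t : ℝ) :
    IsHermitianPreserving (∫ τ in s..t, f τ) := by
  intro X
  rw [ContinuousLinearMap.intervalIntegral_apply (hf.intervalIntegrable s t),
    ContinuousLinearMap.intervalIntegral_apply (hf.intervalIntegrable s t),
    conjTranspose_intervalIntegral (by fun_prop)]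
  exact intervalIntegral.integral_congr fun τ _ => h τ X

/-! ### The free evolution in operator norm. -/

namespace OpenSystem

variable {n J r : ℕ} (Q : OpenSystem n J r)

theorem unitary_zero : Q.unitary 0 = 1 := by
  simp [unitary, NormedSpace.exp_zero]

theorem norm_unitary_le (hH : Q.H.IsHermitian) (t : ℝ) : ‖Q.unitary t‖ ≤ 1 := by
  refine norm_le_one_of_mul_conjTranspose_mul ?_
  have h : (Q.unitary t)ᴴ = Q.unitary (-t) := by
    rw [unitary, unitary, ← Matrix.exp_conjTranspose, Matrix.conjTranspose_smul, hH.eq]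
    simp
  rw [h, ← unitary_add, add_neg_cancel, unitary_zero, one_mul]

/-- Mean value inequality: the derivative of the propagator has norm at most `‖Q.H‖`. -/
theorem norm_unitary_sub_one_le (hH : Q.H.IsHermitian) (t : ℝ) :
    ‖Q.unitary t - 1‖ ≤ |t| * ‖Q.H‖ := by
  have hd : ∀ s, HasDerivAt Q.unitary (Q.unitary s * (-Complex.I • Q.H)) s := by
    intro s
    have h := hasDerivAt_exp_smul_const (𝕂 := ℝ) (-Complex.I • Q.H) s
    have h2 : (fun u : ℝ => NormedSpace.exp (u • (-Complex.I • Q.H))) = Q.unitary := by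
      funext u
      rw [unitary, ← Complex.coe_smul, smul_smul]
      congr 2; ring
    rw [← h2]
    exact h
  have hb : ∀ s, ‖Q.unitary s * (-Complex.I • Q.H)‖ ≤ ‖Q.H‖ := by
    intro s
    refine (norm_mul_le _ _).trans ?_
    rw [norm_smul, norm_neg, Complex.norm_I, one_mul]
    exact mul_le_of_le_one_left (norm_nonneg _) (Q.norm_unitary_le hH s)
  have h := convex_univ.norm_image_sub_le_of_norm_hasDerivWithin_le
    (fun s _ => (hd s).hasDerivWithinAt) (fun s _ => hb s) (Set.mem_univ 0) (Set.mem_univ t)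
  rw [unitary_zero, sub_zero, Real.norm_eq_abs] at h
  linarith

theorem freeEvolution_zero : Q.freeEvolution 0 = 1 := by
  ext1 X
  simp [freeEvolution, unitary_zero]

theorem norm_heisenbergDual_freeEvolution_le (hH : Q.H.IsHermitian) (t : ℝ) :
    ‖heisenbergDual (Q.freeEvolution t)‖ ≤ 1 := by
  rw [freeEvolution, heisenbergDual_mulLeftRight]
  exact (norm_mulLeftRight_le _ _).trans
    (mul_le_one₀ (Q.norm_unitary_le hH _) (norm_nonneg _) (Q.norm_unitary_le hH _))

theorem norm_heisenbergDual_freeEvolution_sub_one_le (hH : Q.H.IsHermitian) (t : ℝ) :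
    ‖heisenbergDual (Q.freeEvolution t) - 1‖ ≤ 2 * |t| * ‖Q.H‖ := by
  have h : heisenbergDual (Q.freeEvolution t) - 1
      = ContinuousLinearMap.mulLeftRight ℂ (QMat n) (Q.unitary (-t) - 1) (Q.unitary t)
        + ContinuousLinearMap.mulLeftRight ℂ (QMat n) 1 (Q.unitary t - 1) := by
    rw [freeEvolution, heisenbergDual_mulLeftRight]
    ext1 X
    simp only [sub_apply, add_apply, ContinuousLinearMap.mulLeftRight_apply,
      one_apply_eq_self]
    noncomm_ring
  rw [h]
  have h0 : ‖(1 : QMat n)‖ = 1 := norm_one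
  have h1 := norm_mulLeftRight_le (Q.unitary (-t) - 1) (Q.unitary t)
  have h2 := norm_mulLeftRight_le 1 (Q.unitary t - 1)
  have h3 := Q.norm_unitary_sub_one_le hH (-t)
  have h4 := Q.norm_unitary_sub_one_le hH t
  have h5 := Q.norm_unitary_le hH t
  rw [h0] at h2
  rw [abs_neg] at h3
  have h6 := mul_le_of_le_one_right (norm_nonneg (Q.unitary (-t) - 1)) h5
  linarith [norm_add_le (ContinuousLinearMap.mulLeftRight ℂ (QMat n) (Q.unitary (-t) - 1)
    (Q.unitary t)) (ContinuousLinearMap.mulLeftRight ℂ (QMat n) 1 (Q.unitary t - 1))]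

/-! ### Bounds on the noise generator -/

theorem norm_jump_le (hS : ∀ j, ‖Q.S j‖ ≤ 1) (μ : Fin r) : ‖Q.jump μ‖ ≤ ∑ j, ‖Q.g j μ‖ := by
  refine (norm_sum_le _ _).trans (Finset.sum_le_sum fun j _ => ?_)
  rw [norm_smul]
  exact mul_le_of_le_one_right (norm_nonneg _) (hS j)

theorem norm_heisenberg_le (hH : Q.H.IsHermitian) (A : QMat n) (t : ℝ) :
    ‖Q.heisenberg A t‖ ≤ ‖A‖ := by
  have h := (norm_mul_le (Q.unitary (-t) * A) (Q.unitary t)).trans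
    (mul_le_of_le_one_right (norm_nonneg _) (Q.norm_unitary_le hH t))
  exact (h.trans (norm_mul_le _ _)).trans
    (mul_le_of_le_one_left (norm_nonneg _) (Q.norm_unitary_le hH _))

theorem norm_exp_I_mul_mul (z : ℂ) (τ : ℝ) :
    ‖Complex.exp (Complex.I * z * τ)‖ = Real.exp (-(z.im * τ)) := by
  rw [Complex.norm_exp]
  congr 1
  simp

theorem norm_jump_mul_le (hH : Q.H.IsHermitian) (hS : ∀ j, ‖Q.S j‖ ≤ 1) (μ : Fin r) (τ : ℝ) :
    4 * (‖Q.jump μ‖ *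
        ‖Complex.exp (Complex.I * Q.ω μ * τ) • Q.heisenberg (Q.jump μ) (-τ)‖)
      ≤ 4 * (∑ j, ‖Q.g j μ‖) ^ 2 * Real.exp (-((Q.ω μ).im * τ)) := by
  have h1 := Q.norm_jump_le hS μ
  have h2 := (Q.norm_heisenberg_le hH (Q.jump μ) (-τ)).trans h1
  rw [norm_smul, norm_exp_I_mul_mul]
  calc _ ≤ 4 * ((∑ j, ‖Q.g j μ‖) * (Real.exp (-((Q.ω μ).im * τ)) * ∑ j, ‖Q.g j μ‖)) := by
        gcongr
    _ = _ := by ring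

theorem norm_noiseKernel_le (hH : Q.H.IsHermitian) (hS : ∀ j, ‖Q.S j‖ ≤ 1) (μ : Fin r) (τ : ℝ) :
    ‖Q.noiseKernel μ τ‖ ≤ 4 * (∑ j, ‖Q.g j μ‖) ^ 2 * Real.exp (-((Q.ω μ).im * τ)) :=
  (norm_lindbladForm_le _ _).trans (Q.norm_jump_mul_le hH hS μ τ)

theorem norm_heisenbergDual_noiseKernel_le (hH : Q.H.IsHermitian) (hS : ∀ j, ‖Q.S j‖ ≤ 1)
    (μ : Fin r) (τ : ℝ) : ‖heisenbergDual (Q.noiseKernel μ τ)‖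
      ≤ 4 * (∑ j, ‖Q.g j μ‖) ^ 2 * Real.exp (-((Q.ω μ).im * τ)) :=
  (norm_heisenbergDual_lindbladForm_le _ _).trans (Q.norm_jump_mul_le hH hS μ τ)

/-- A bound for the increment of the noise generator over the time interval `[s, t]`. -/
noncomputable def noiseMass (s t : ℝ) : ℝ :=
  Q.lam ^ 2 * ∑ μ, ∫ τ in s..t, 4 * (∑ j, ‖Q.g j μ‖) ^ 2 * Real.exp (-((Q.ω μ).im * τ))

/-- Additivity makes the increments over all steps sum to one integral over [0, T], with no factor
`M`. -/
theorem noiseMass_add (s t u : ℝ) : Q.noiseMass s t + Q.noiseMass t u = Q.noiseMass s u := by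
  unfold noiseMass
  rw [← mul_add, ← Finset.sum_add_distrib]
  congr 1
  refine Finset.sum_congr rfl fun μ _ => intervalIntegral.integral_add_adjacent_intervals ?_ ?_
  all_goals exact Continuous.intervalIntegrable (by fun_prop) _ _

theorem noiseMass_nonneg {s t : ℝ} (h : s ≤ t) : 0 ≤ Q.noiseMass s t :=
  mul_nonneg (sq_nonneg _) (Finset.sum_nonneg fun _ _ =>
    intervalIntegral.integral_nonneg h fun _ _ => by positivity)

/-- Each exponential integrates to at most 1 / Im ω, uniformly in `t`. The factor 2 remains because
the kernel bound carries 4 and `G₁` only 2. -/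
theorem noiseMass_zero_le (hω : ∀ μ, 0 < (Q.ω μ).im) (t : ℝ) :
    Q.noiseMass 0 t ≤ 2 * (Q.lam ^ 2 * Q.G₁) := by
  have h : ∀ μ, ∫ τ in (0 : ℝ)..t, 4 * (∑ j, ‖Q.g j μ‖) ^ 2 * Real.exp (-((Q.ω μ).im * τ))
      ≤ 4 * ((∑ j, ‖Q.g j μ‖) ^ 2 * (1 / (Q.ω μ).im)) := by
    intro μ
    have hpos := hω μ
    have h1 : ∫ τ in (0 : ℝ)..t, Real.exp (-((Q.ω μ).im * τ))
        = (1 - Real.exp (-((Q.ω μ).im * t))) / (Q.ω μ).im := by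
      have h2 : ∀ τ ∈ Set.uIcc 0 t, HasDerivAt
          (fun τ => -Real.exp (-((Q.ω μ).im * τ)) / (Q.ω μ).im)
          (Real.exp (-((Q.ω μ).im * τ))) τ := by
        intro τ _
        have h3 : HasDerivAt (fun τ : ℝ => -((Q.ω μ).im * τ)) (-((Q.ω μ).im * 1)) τ :=
          ((hasDerivAt_id τ).const_mul _).neg
        have h4 := (h3.exp.neg).div_const (Q.ω μ).im
        have h5 : -(Real.exp (-((Q.ω μ).im * τ)) * -((Q.ω μ).im * 1)) / (Q.ω μ).im
            = Real.exp (-((Q.ω μ).im * τ)) := by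
          field_simp
        rw [← h5]
        exact h4
      rw [intervalIntegral.integral_eq_sub_of_hasDerivAt h2
        (Continuous.intervalIntegrable (by fun_prop) _ _)]
      simp
      ring
    rw [intervalIntegral.integral_const_mul, h1, mul_assoc]
    have h5 := Real.exp_pos (-((Q.ω μ).im * t))
    gcongr
    linarith
  unfold noiseMass G₁
  calc _ ≤ Q.lam ^ 2 * ∑ μ, 4 * ((∑ j, ‖Q.g j μ‖) ^ 2 * (1 / (Q.ω μ).im)) := by
        gcongr with μ _
        exact h μ
    _ = _ := by rw [← Finset.mul_sum]; ring

/-- The increment is the kernel integrated over [s, t], and `D` commutes with integration. It is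
used with `D` the dual map and with `D` the identity. -/
theorem norm_map_noiseGenerator_sub_le (D : Superop n →L[ℂ] Superop n)
    (hD : ∀ μ τ, ‖D (Q.noiseKernel μ τ)‖
      ≤ 4 * (∑ j, ‖Q.g j μ‖) ^ 2 * Real.exp (-((Q.ω μ).im * τ))) {s t : ℝ} (h : s ≤ t) :
    ‖D (Q.noiseGenerator t - Q.noiseGenerator s)‖ ≤ Q.noiseMass s t := by
  have h1 : Q.noiseGenerator t - Q.noiseGenerator s
      = ((Q.lam : ℂ) ^ 2) • ∑ μ, ∫ τ in s..t, Q.noiseKernel μ τ := by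
    unfold noiseGenerator
    rw [← smul_sub, ← Finset.sum_sub_distrib]
    congr 1
    refine Finset.sum_congr rfl fun μ _ => ?_
    exact intervalIntegral.integral_interval_sub_left
      ((Q.continuous_noiseKernel μ).intervalIntegrable _ _)
      ((Q.continuous_noiseKernel μ).intervalIntegrable _ _)
  rw [h1, map_smul, norm_smul, map_sum, norm_pow, Complex.norm_real, Real.norm_eq_abs, sq_abs]
  unfold noiseMass
  refine mul_le_mul_of_nonneg_left ((norm_sum_le _ _).trans
    (Finset.sum_le_sum fun μ _ => ?_)) (sq_nonneg _)
  rw [← D.intervalIntegral_comp_comm ((Q.continuous_noiseKernel μ).intervalIntegrable _ _)]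
  exact intervalIntegral.norm_integral_le_of_norm_le h
    (Filter.Eventually.of_forall fun τ _ => hD μ τ)
    (Continuous.intervalIntegrable (by fun_prop) _ _)

theorem noiseGenerator_zero : Q.noiseGenerator 0 = 0 := by
  simp [noiseGenerator]

theorem norm_heisenbergDual_noiseGenerator_sub_le (hH : Q.H.IsHermitian)
    (hS : ∀ j, ‖Q.S j‖ ≤ 1) {s t : ℝ} (h : s ≤ t) :
    ‖heisenbergDual (Q.noiseGenerator t) - heisenbergDual (Q.noiseGenerator s)‖
      ≤ Q.noiseMass s t := by
  rw [← map_sub]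
  exact Q.norm_map_noiseGenerator_sub_le _ (Q.norm_heisenbergDual_noiseKernel_le hH hS) h

theorem norm_heisenbergDual_noiseGenerator_le (hH : Q.H.IsHermitian) (hS : ∀ j, ‖Q.S j‖ ≤ 1)
    (hω : ∀ μ, 0 < (Q.ω μ).im) {t : ℝ} (h : 0 ≤ t) :
    ‖heisenbergDual (Q.noiseGenerator t)‖ ≤ 2 * (Q.lam ^ 2 * Q.G₁) := by
  have h1 := Q.norm_heisenbergDual_noiseGenerator_sub_le hH hS h
  rw [noiseGenerator_zero, map_zero, sub_zero] at h1
  exact h1.trans (Q.noiseMass_zero_le hω t)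

theorem norm_noiseGenerator_le (hH : Q.H.IsHermitian) (hS : ∀ j, ‖Q.S j‖ ≤ 1)
    (hω : ∀ μ, 0 < (Q.ω μ).im) {t : ℝ} (h : 0 ≤ t) :
    ‖Q.noiseGenerator t‖ ≤ 2 * (Q.lam ^ 2 * Q.G₁) := by
  have h1 := Q.norm_map_noiseGenerator_sub_le (ContinuousLinearMap.id ℂ _)
    (Q.norm_noiseKernel_le hH hS) h
  rw [noiseGenerator_zero, sub_zero] at h1
  exact h1.trans (Q.noiseMass_zero_le hω t)

theorem isHermitianPreserving_noiseGenerator (t : ℝ) :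
    IsHermitianPreserving (Q.noiseGenerator t) := by
  have h : ∀ μ, IsHermitianPreserving (∫ τ in (0 : ℝ)..t, Q.noiseKernel μ τ) := fun μ =>
    isHermitianPreserving_intervalIntegral (Q.continuous_noiseKernel μ)
      (fun τ => isHermitianPreserving_lindbladForm _ _) 0 t
  intro X
  simp only [noiseGenerator, smul_apply, sum_apply, Matrix.conjTranspose_smul,
    Matrix.conjTranspose_sum, fun μ => h μ X]
  simp

theorem isHermitianPreserving_recovery (t δt : ℝ) : IsHermitianPreserving (Q.recovery t δt) := by
  intro X
  have h := Q.isHermitianPreserving_noiseGenerator (t + δt) X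
  simp [recovery, h, Matrix.conjTranspose_smul]

end OpenSystem

namespace OpenSystem

variable {n J r : ℕ} (Q : OpenSystem n J r)

/-! ### One step of the mitigated evolution -/

theorem heisenbergDual_duhamel {s t : ℝ} {E : ℝ → Superop n} (hE : Q.IsNoisyEvolutionFrom s E)
    (h : s ≤ t) : heisenbergDual (E t) = heisenbergDual (Q.freeEvolution (t - s))
      + ∫ τ in s..t, heisenbergDual (E τ) *
          (heisenbergDual (Q.noiseGenerator τ) * heisenbergDual (Q.freeEvolution (t - τ))) := by
  have hU := Q.continuous_freeEvolution
  have hL := Q.continuous_noiseGenerator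
  have hint : IntervalIntegrable
      (fun τ => Q.freeEvolution (t - τ) * Q.noiseGenerator τ * E τ) volume s t := by
    refine ContinuousOn.intervalIntegrable ?_
    rw [Set.uIcc_of_le h]
    exact ContinuousOn.mul (Continuous.continuousOn (by fun_prop))
      (hE.1.mono Set.Icc_subset_Ici_self)
  rw [hE.2 t h, map_add, ← heisenbergDual.intervalIntegral_comp_comm hint]
  simp only [heisenbergDual_mul]

theorem intervalIntegrable_duhamel {s t : ℝ} {E : ℝ → Superop n}
    (hE : Q.IsNoisyEvolutionFrom s E) (h : s ≤ t) : IntervalIntegrable (fun τ =>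
      heisenbergDual (E τ) *
        (heisenbergDual (Q.noiseGenerator τ) * heisenbergDual (Q.freeEvolution (t - τ))))
      volume s t := by
  have hU := Q.continuous_freeEvolution
  have hL := Q.continuous_noiseGenerator
  refine ContinuousOn.intervalIntegrable ?_
  rw [Set.uIcc_of_le h]
  exact (heisenbergDual.continuous.comp_continuousOn (hE.1.mono Set.Icc_subset_Ici_self)).mul
    (Continuous.continuousOn (by fun_prop))

theorem norm_heisenbergDual_noisyEvolution_sub_le_of_le (hH : Q.H.IsHermitian) {L m s t : ℝ}
    {E : ℝ → Superop n} (hE : Q.IsNoisyEvolutionFrom s E) (hs : 0 ≤ s)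
    (hL : ∀ τ, 0 ≤ τ → ‖heisenbergDual (Q.noiseGenerator τ)‖ ≤ L) (h : s ≤ t)
    (hm : ∀ τ ∈ Set.Icc s t, ‖heisenbergDual (E τ)‖ ≤ m) :
    ‖heisenbergDual (E t) - heisenbergDual (Q.freeEvolution (t - s))‖ ≤ L * (t - s) * m := by
  rw [Q.heisenbergDual_duhamel hE h, add_sub_cancel_left]
  have hm0 : 0 ≤ m := (norm_nonneg _).trans (hm s ⟨le_rfl, h⟩)
  have hL0 : 0 ≤ L := (norm_nonneg _).trans (hL s hs)
  have h1 : ∀ τ ∈ Set.uIoc s t, ‖heisenbergDual (E τ) * (heisenbergDual (Q.noiseGenerator τ) *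
      heisenbergDual (Q.freeEvolution (t - τ)))‖ ≤ m * (L * 1) := by
    intro τ hτ
    rw [Set.uIoc_of_le h] at hτ
    exact (norm_mul_le _ _).trans (mul_le_mul (hm τ ⟨hτ.1.le, hτ.2⟩)
      ((norm_mul_le _ _).trans (mul_le_mul (hL τ (by linarith [hτ.1]))
        (Q.norm_heisenbergDual_freeEvolution_le hH _) (norm_nonneg _) hL0))
      (norm_nonneg _) hm0)
  refine (intervalIntegral.norm_integral_le_of_norm_le_const h1).trans (le_of_eq ?_)
  rw [abs_of_nonneg (by linarith)]
  ring

/-- A bootstrap instead of Grönwall: at a point where the continuous norm attains its maximum m,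
Duhamel's formula gives m ≤ 1 + L d m. -/
theorem norm_heisenbergDual_noisyEvolution_mul_le (hH : Q.H.IsHermitian) {L s d : ℝ}
    {E : ℝ → Superop n} (hE : Q.IsNoisyEvolutionFrom s E) (hs : 0 ≤ s) (hd : 0 ≤ d)
    (hL : ∀ τ, 0 ≤ τ → ‖heisenbergDual (Q.noiseGenerator τ)‖ ≤ L) (hLd : L * d ≤ 1)
    {t : ℝ} (ht : t ∈ Set.Icc s (s + d)) : ‖heisenbergDual (E t)‖ * (1 - L * d) ≤ 1 := by
  have hL0 : 0 ≤ L := (norm_nonneg _).trans (hL s hs)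
  have hc : ContinuousOn (fun t => ‖heisenbergDual (E t)‖) (Set.Icc s (s + d)) :=
    (heisenbergDual.continuous.comp_continuousOn (hE.1.mono Set.Icc_subset_Ici_self)).norm
  obtain ⟨u, hu, hmax⟩ := isCompact_Icc.exists_isMaxOn
    (Set.nonempty_Icc.mpr (by linarith : s ≤ s + d)) hc
  have hm : ∀ τ ∈ Set.Icc s u, ‖heisenbergDual (E τ)‖ ≤ ‖heisenbergDual (E u)‖ := fun τ hτ =>
    hmax ⟨hτ.1, hτ.2.trans hu.2⟩
  have h2 := Q.norm_heisenbergDual_noisyEvolution_sub_le_of_le hH hE hs hL hu.1 hm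
  have h3 := Q.norm_heisenbergDual_freeEvolution_le hH (u - s)
  have h4 := norm_le_norm_add_norm_sub' (heisenbergDual (E u))
    (heisenbergDual (Q.freeEvolution (u - s)))
  have h5 : ‖heisenbergDual (E t)‖ ≤ ‖heisenbergDual (E u)‖ := hmax ht
  have h6 : L * (u - s) * ‖heisenbergDual (E u)‖ ≤ L * d * ‖heisenbergDual (E u)‖ := by
    gcongr
    linarith [hu.2]
  have h7 : ‖heisenbergDual (E u)‖ * (1 - L * d) ≤ 1 := by linarith
  exact (mul_le_mul_of_nonneg_right h5 (by linarith)).trans h7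

theorem norm_heisenbergDual_noisyEvolution_le (hH : Q.H.IsHermitian) {L s d : ℝ}
    {E : ℝ → Superop n} (hE : Q.IsNoisyEvolutionFrom s E) (hs : 0 ≤ s) (hd : 0 ≤ d)
    (hL : ∀ τ, 0 ≤ τ → ‖heisenbergDual (Q.noiseGenerator τ)‖ ≤ L) (hLd : L * d ≤ 1 / 2)
    {t : ℝ} (ht : t ∈ Set.Icc s (s + d)) : ‖heisenbergDual (E t)‖ ≤ 1 + 2 * (L * d) := by
  have hL0 : 0 ≤ L := (norm_nonneg _).trans (hL s hs)
  have h0 : 0 ≤ L * d := mul_nonneg hL0 hd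
  have h := Q.norm_heisenbergDual_noisyEvolution_mul_le hH hE hs hd hL (by linarith) ht
  -- For 0 ≤ x ≤ 1/2, (1 + 2x)(1 - x) ≥ 1.
  nlinarith

theorem norm_heisenbergDual_noisyEvolution_sub_le (hH : Q.H.IsHermitian) {L s d : ℝ}
    {E : ℝ → Superop n} (hE : Q.IsNoisyEvolutionFrom s E) (hs : 0 ≤ s) (hd : 0 ≤ d)
    (hL : ∀ τ, 0 ≤ τ → ‖heisenbergDual (Q.noiseGenerator τ)‖ ≤ L) (hLd : L * d ≤ 1 / 2)
    {t : ℝ} (ht : t ∈ Set.Icc s (s + d)) :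
    ‖heisenbergDual (E t) - heisenbergDual (Q.freeEvolution (t - s))‖ ≤ 2 * (L * d) := by
  have hL0 : 0 ≤ L := (norm_nonneg _).trans (hL s hs)
  refine (Q.norm_heisenbergDual_noisyEvolution_sub_le_of_le hH hE hs hL ht.1 (m := 2)
    fun τ hτ => ?_).trans ?_
  · have := Q.norm_heisenbergDual_noisyEvolution_le hH hE hs hd hL hLd
      (t := τ) ⟨hτ.1, hτ.2.trans ht.2⟩
    linarith
  · have : L * (t - s) ≤ L * d := by
      gcongr
      linarith [ht.2]
    linarith

/-- Telescoping in five terms: twice a noisy evolution is replaced by the free one (2L²d each),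
twice a free factor is replaced by 1 next to the generator (2Ld‖H‖ each), and once the generator is
frozen at the end of the step (the noise mass). -/
theorem norm_duhamel_integrand_sub_le (hH : Q.H.IsHermitian) (hS : ∀ j, ‖Q.S j‖ ≤ 1)
    {L s d : ℝ} {E : ℝ → Superop n} (hE : Q.IsNoisyEvolutionFrom s E) (hs : 0 ≤ s) (hd : 0 ≤ d)
    (hL : ∀ τ, 0 ≤ τ → ‖heisenbergDual (Q.noiseGenerator τ)‖ ≤ L) (hLd : L * d ≤ 1 / 2)
    {τ : ℝ} (hτ : τ ∈ Set.Icc s (s + d)) :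
    ‖heisenbergDual (E τ) * (heisenbergDual (Q.noiseGenerator τ) *
        heisenbergDual (Q.freeEvolution (s + d - τ)))
      - heisenbergDual (E (s + d)) * heisenbergDual (Q.noiseGenerator (s + d))‖
      ≤ 4 * L ^ 2 * d + 4 * L * d * ‖Q.H‖ + Q.noiseMass s (s + d) := by
  have hL0 : 0 ≤ L := (norm_nonneg _).trans (hL s hs)
  have e1 := Q.norm_heisenbergDual_noisyEvolution_sub_le hH hE hs hd hL hLd hτ
  have e2 := Q.norm_heisenbergDual_noisyEvolution_sub_le hH hE hs hd hL hLd
    (t := s + d) ⟨by linarith, le_rfl⟩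
  have l1 := hL τ (by linarith [hτ.1])
  have l2 := hL (s + d) (by linarith)
  have u1 := Q.norm_heisenbergDual_freeEvolution_le hH (s + d - τ)
  have u2 := Q.norm_heisenbergDual_freeEvolution_le hH (τ - s)
  have w : ‖heisenbergDual (Q.freeEvolution (s + d - τ)) - 1‖ ≤ 2 * d * ‖Q.H‖ := by
    refine (Q.norm_heisenbergDual_freeEvolution_sub_one_le hH _).trans ?_
    rw [abs_of_nonneg (by linarith [hτ.2])]
    gcongr
    linarith [hτ.1]
  have v : ‖heisenbergDual (Q.noiseGenerator τ) - heisenbergDual (Q.noiseGenerator (s + d))‖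
      ≤ Q.noiseMass s (s + d) := by
    rw [norm_sub_rev]
    refine (Q.norm_heisenbergDual_noiseGenerator_sub_le hH hS hτ.2).trans ?_
    rw [← Q.noiseMass_add s τ]
    linarith [Q.noiseMass_nonneg hτ.1]
  have hU : heisenbergDual (Q.freeEvolution (s + d - s)) =
      heisenbergDual (Q.freeEvolution (τ - s)) * heisenbergDual (Q.freeEvolution (s + d - τ)) := by
    rw [← heisenbergDual_mul, ← freeEvolution_add]
    congr 2; ring
  rw [hU] at e2
  generalize heisenbergDual (E τ) = A at *
  generalize heisenbergDual (E (s + d)) = B at *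
  generalize heisenbergDual (Q.noiseGenerator τ) = F at *
  generalize heisenbergDual (Q.noiseGenerator (s + d)) = G at *
  generalize heisenbergDual (Q.freeEvolution (s + d - τ)) = U at *
  generalize heisenbergDual (Q.freeEvolution (τ - s)) = V at *
  have key : A * (F * U) - B * G = (A - V) * (F * U) + V * ((F - G) * U) + V * (G * (U - 1))
      - V * ((U - 1) * G) - (B - V * U) * G := by noncomm_ring
  have hd0 : 0 ≤ 2 * (L * d) := by positivity
  have n1 : ‖(A - V) * (F * U)‖ ≤ 2 * (L * d) * (L * 1) := (norm_mul_le _ _).trans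
    (mul_le_mul e1 ((norm_mul_le _ _).trans (mul_le_mul l1 u1 (norm_nonneg _) hL0))
      (norm_nonneg _) hd0)
  have hV0 := (norm_nonneg _).trans v
  have n2 : ‖V * ((F - G) * U)‖ ≤ 1 * (Q.noiseMass s (s + d) * 1) := (norm_mul_le _ _).trans
    (mul_le_mul u2 ((norm_mul_le _ _).trans (mul_le_mul v u1 (norm_nonneg _) hV0))
      (norm_nonneg _) zero_le_one)
  have n3 : ‖V * (G * (U - 1))‖ ≤ 1 * (L * (2 * d * ‖Q.H‖)) := (norm_mul_le _ _).trans
    (mul_le_mul u2 ((norm_mul_le _ _).trans (mul_le_mul l2 w (norm_nonneg _) hL0))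
      (norm_nonneg _) zero_le_one)
  have n4 : ‖V * ((U - 1) * G)‖ ≤ 1 * (2 * d * ‖Q.H‖ * L) := (norm_mul_le _ _).trans
    (mul_le_mul u2 ((norm_mul_le _ _).trans (mul_le_mul w l2 (norm_nonneg _) (by positivity)))
      (norm_nonneg _) zero_le_one)
  have n5 : ‖(B - V * U) * G‖ ≤ 2 * (L * d) * L := (norm_mul_le _ _).trans
    (mul_le_mul e2 l2 (norm_nonneg _) hd0)
  rw [key]
  refine (norm_sub_le _ _).trans ((add_le_add_left (norm_sub_le _ _) _).trans ?_)
  refine (add_le_add_left (add_le_add_left (norm_add_le _ _) _) _).trans ?_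
  refine (add_le_add_left (add_le_add_left (add_le_add_left (norm_add_le _ _) _) _) _).trans ?_
  linarith

/-- The error of one step of the mitigated evolution. -/
theorem norm_heisenbergDual_recovery_mul_sub_le (hH : Q.H.IsHermitian) (hS : ∀ j, ‖Q.S j‖ ≤ 1)
    {L s d : ℝ} {E : ℝ → Superop n} (hE : Q.IsNoisyEvolutionFrom s E) (hs : 0 ≤ s) (hd : 0 ≤ d)
    (hL : ∀ τ, 0 ≤ τ → ‖heisenbergDual (Q.noiseGenerator τ)‖ ≤ L) (hLd : L * d ≤ 1 / 2) :
    ‖heisenbergDual (Q.recovery s d * E (s + d)) - heisenbergDual (Q.freeEvolution d)‖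
      ≤ d * (4 * L ^ 2 * d + 4 * L * d * ‖Q.H‖ + Q.noiseMass s (s + d)) := by
  have hle : s ≤ s + d := by linarith
  -- The correction subtracted by the recovery operator is the integral over the step of the
  -- constant end value, so it can be placed under the Duhamel integral.
  have h1 : heisenbergDual (Q.recovery s d * E (s + d)) - heisenbergDual (Q.freeEvolution d)
      = ∫ τ in s..(s + d), (heisenbergDual (E τ) * (heisenbergDual (Q.noiseGenerator τ) *
        heisenbergDual (Q.freeEvolution (s + d - τ)))
      - heisenbergDual (E (s + d)) * heisenbergDual (Q.noiseGenerator (s + d))) := by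
    rw [intervalIntegral.integral_sub (Q.intervalIntegrable_duhamel hE hle) (by simp),
      intervalIntegral.integral_const, add_sub_cancel_left, heisenbergDual_mul, recovery, map_sub,
      map_smul, heisenbergDual_one, mul_sub, mul_one, mul_smul_comm, Complex.coe_smul]
    have h2 := Q.heisenbergDual_duhamel hE hle
    rw [add_sub_cancel_left] at h2
    rw [sub_right_comm, sub_left_inj, sub_eq_iff_eq_add']
    exact h2
  rw [h1]
  refine (intervalIntegral.norm_integral_le_of_norm_le_const fun τ hτ =>
    Q.norm_duhamel_integrand_sub_le hH hS hE hs hd hL hLd (τ := τ) ?_).trans (le_of_eq ?_)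
  · rw [Set.uIoc_of_le hle] at hτ
    exact ⟨hτ.1.le, hτ.2⟩
  · rw [add_sub_cancel_left, abs_of_nonneg hd, mul_comm]

/-! ### The mitigated evolution -/

/-- The mean evolution over `M` steps of the mitigated dynamics. -/
noncomputable def mitigatedEvolution (δt : ℝ) : ℕ → Superop n
  | 0 => 1
  | M + 1 => Q.recovery (M * δt) δt * Q.noisyEvolution ((M + 1 : ℕ) * δt) (M * δt)
      * mitigatedEvolution δt M

/-- If the step errors are e_k, contractivity of the free evolution bounds the total by ∏(1 + e_k) -
1 ≤ exp(∑ e_k) - 1. The exponential form closes the induction, since (exp a - 1)(1 + e) + e ≤ exp(a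
+ e) - 1. -/
theorem norm_heisenbergDual_mitigatedEvolution_sub_le (hH : Q.H.IsHermitian)
    (hS : ∀ j, ‖Q.S j‖ ≤ 1) {L δt : ℝ} (hδt : 0 ≤ δt)
    (hL : ∀ τ, 0 ≤ τ → ‖heisenbergDual (Q.noiseGenerator τ)‖ ≤ L) (hLd : L * δt ≤ 1 / 2)
    (M : ℕ) :
    ‖heisenbergDual (Q.mitigatedEvolution δt M) - heisenbergDual (Q.freeEvolution (M * δt))‖
      ≤ Real.exp (M * δt * (4 * L ^ 2 * δt + 4 * L * δt * ‖Q.H‖)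
          + δt * Q.noiseMass 0 (M * δt)) - 1 := by
  induction M with
  | zero => simp [mitigatedEvolution, freeEvolution_zero, noiseMass]
  | succ M ih =>
    have hs : 0 ≤ (M : ℝ) * δt := by positivity
    have hM : ((M + 1 : ℕ) : ℝ) * δt = M * δt + δt := by push_cast; ring
    have h1 := Q.norm_heisenbergDual_recovery_mul_sub_le hH hS
      (Q.noisyEvolution_spec (M * δt)) hs hδt hL hLd
    have h2 : Q.noiseMass 0 (M * δt + δt)
        = Q.noiseMass 0 (M * δt) + Q.noiseMass (M * δt) (M * δt + δt) :=
      (Q.noiseMass_add _ _ _).symm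
    have h8 : heisenbergDual (Q.mitigatedEvolution δt (M + 1))
        = heisenbergDual (Q.mitigatedEvolution δt M) * heisenbergDual
          (Q.recovery (M * δt) δt * Q.noisyEvolution (M * δt + δt) (M * δt)) := by
      rw [mitigatedEvolution, heisenbergDual_mul (_ * _), hM]
    have h9 : heisenbergDual (Q.freeEvolution (M * δt + δt))
        = heisenbergDual (Q.freeEvolution (M * δt)) * heisenbergDual (Q.freeEvolution δt) := by
      rw [add_comm, freeEvolution_add, heisenbergDual_mul]
    rw [h8, hM, h2, h9]
    have u1 := Q.norm_heisenbergDual_freeEvolution_le hH (M * δt)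
    have u2 := Q.norm_heisenbergDual_freeEvolution_le hH δt
    have h3 : (M * δt + δt) * (4 * L ^ 2 * δt + 4 * L * δt * ‖Q.H‖)
          + δt * (Q.noiseMass 0 (M * δt) + Q.noiseMass (M * δt) (M * δt + δt))
        = (M * δt * (4 * L ^ 2 * δt + 4 * L * δt * ‖Q.H‖) + δt * Q.noiseMass 0 (M * δt))
          + δt * (4 * L ^ 2 * δt + 4 * L * δt * ‖Q.H‖
            + Q.noiseMass (M * δt) (M * δt + δt)) := by ring
    rw [h3, Real.exp_add]
    generalize M * δt * (4 * L ^ 2 * δt + 4 * L * δt * ‖Q.H‖) + δt * Q.noiseMass 0 (M * δt) = a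
      at *
    generalize δt * (4 * L ^ 2 * δt + 4 * L * δt * ‖Q.H‖
      + Q.noiseMass (M * δt) (M * δt + δt)) = e at *
    generalize heisenbergDual (Q.mitigatedEvolution δt M) = P at *
    generalize heisenbergDual (Q.recovery (M * δt) δt
      * Q.noisyEvolution (M * δt + δt) (M * δt)) = A at *
    generalize heisenbergDual (Q.freeEvolution (M * δt)) = V at *
    generalize heisenbergDual (Q.freeEvolution δt) = U at *
    have key : P * A - V * U = (P - V) * A + V * (A - U) := by noncomm_ring
    have n0 : ‖A‖ ≤ 1 + e := (norm_le_norm_add_norm_sub' A U).trans (add_le_add u2 h1)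
    have h4 := (norm_nonneg _).trans ih
    have h5 := (norm_nonneg _).trans h1
    have n1 : ‖(P - V) * A‖ ≤ (Real.exp a - 1) * (1 + e) :=
      (norm_mul_le _ _).trans (mul_le_mul ih n0 (norm_nonneg _) h4)
    have n2 : ‖V * (A - U)‖ ≤ 1 * e :=
      (norm_mul_le _ _).trans (mul_le_mul u1 h1 (norm_nonneg _) zero_le_one)
    have h6 := Real.add_one_le_exp e
    rw [key]
    refine (norm_add_le _ _).trans ?_
    nlinarith [Real.exp_pos a]

end OpenSystem

/-! ### Expectation values in a density matrix. -/

/-- Factoring ρ = BᴴB gives tr(Xρ) = ∑ ⟨v i, X v i⟩ with ∑ ‖v i‖² = tr ρ = 1. This replaces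
trace-norm duality. -/
theorem IsDensity.norm_trace_mul_le {n : ℕ} {ρ : QMat n} (hρ : IsDensity ρ) (X : QMat n) :
    ‖(X * ρ).trace‖ ≤ ‖X‖ := by
  obtain ⟨B, hB⟩ : ∃ B : QMat n, ρ = Bᴴ * B := by
    open scoped MatrixOrder in
    exact CStarAlgebra.nonneg_iff_eq_star_mul_self.mp hρ.1.nonneg
  let v : (Fin n → Fin 2) → EuclideanSpace ℂ (Fin n → Fin 2) :=
    fun i => WithLp.toLp 2 fun j => star (B i j)
  have h1 : ∀ Y : QMat n, (Y * ρ).trace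
      = ∑ i, inner ℂ (v i) ((EuclideanSpace.equiv _ ℂ).symm (Y *ᵥ v i)) := by
    intro Y
    rw [hB, ← mul_assoc, Matrix.trace_mul_comm, Matrix.trace]
    refine Finset.sum_congr rfl fun i _ => ?_
    simp only [Matrix.diag_apply, Matrix.mul_apply, Matrix.conjTranspose_apply, PiLp.inner_apply,
      v, RCLike.inner_apply, EuclideanSpace.equiv]
    refine Finset.sum_congr rfl fun j _ => ?_
    simp [Matrix.mulVec, dotProduct, mul_comm]
  have h2 : (∑ i, ‖v i‖ ^ 2 : ℝ) = 1 := by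
    have h3 := h1 1
    rw [one_mul, hρ.2] at h3
    have h4 : ∀ i, inner ℂ (v i) ((EuclideanSpace.equiv _ ℂ).symm ((1 : QMat n) *ᵥ v i))
        = ((‖v i‖ ^ 2 : ℝ) : ℂ) := by
      intro i
      rw [Matrix.one_mulVec]
      push_cast
      exact inner_self_eq_norm_sq_to_K (𝕜 := ℂ) (v i)
    simp only [h4] at h3
    exact_mod_cast h3.symm
  rw [h1]
  calc _ ≤ ∑ i, ‖v i‖ * (‖X‖ * ‖v i‖) := (norm_sum_le _ _).trans (Finset.sum_le_sum fun i _ =>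
        (norm_inner_le_norm _ _).trans (mul_le_mul_of_nonneg_left
          (Matrix.l2_opNorm_mulVec X (v i)) (norm_nonneg _)))
    _ = ‖X‖ * ∑ i, ‖v i‖ ^ 2 := by
        rw [Finset.mul_sum]
        exact Finset.sum_congr rfl fun i _ => by ring
    _ = ‖X‖ := by rw [h2, mul_one]

/-! ### Hoeffding's inequality for finite sampling -/

theorem integral_comp_of_finite {α Ω : Type*} [Fintype α] [MeasurableSpace α]
    [MeasurableSingletonClass α] [MeasurableSpace Ω] (P : Measure Ω) [IsProbabilityMeasure P]
    {X : Ω → α} (hX : Measurable X) (f : α → ℝ) :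
    ∫ w, f (X w) ∂P = ∑ v, P.real {w | X w = v} * f v := by
  have : IsProbabilityMeasure (P.map X) := Measure.isProbabilityMeasure_map hX.aemeasurable
  rw [← integral_map hX.aemeasurable (measurable_of_finite f).aestronglyMeasurable,
    integral_fintype Integrable.of_finite]
  refine Finset.sum_congr rfl fun v _ => ?_
  rw [map_measureReal_apply hX (measurableSet_singleton v)]
  rfl

/-- Variables with values in [-R, R] are sub-Gaussian, after centring, with parameter R². Each of
the two tails has probability at most exp(-Nη²/(2R²)) ≤ δ/2. -/
theorem measureReal_abs_mean_sub_le {α Ω : Type*} [Fintype α] [MeasurableSpace α]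
    [MeasurableSingletonClass α] [MeasurableSpace Ω] (P : Measure Ω) [IsProbabilityMeasure P]
    {N : ℕ} (X : Fin N → Ω → α) (hX : ∀ m, Measurable (X m)) (hind : iIndepFun X P)
    (f : α → ℝ) {p : α → ℝ} (hp : ∀ m v, P.real {w | X m w = v} = p v) {R η δ : ℝ} (hR : 0 < R)
    (hf : ∀ v, |f v| ≤ R) (hη : 0 < η) (hδ : 0 < δ) (hδ1 : δ ≤ 1)
    (hN : 2 * R ^ 2 * Real.log (2 / δ) / η ^ 2 ≤ N) :
    1 - δ ≤ P.real {w | |(∑ v, p v * f v) - 1 / N * ∑ m, f (X m w)| ≤ η} := by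
  -- Here δ ≤ 1 matters: a positive logarithm forces `N` to be positive, so the mean is a genuine
  -- one.
  have hlog : 0 < Real.log (2 / δ) := Real.log_pos (by rw [lt_div_iff₀ hδ]; linarith)
  have hN0 : (0 : ℝ) < N := lt_of_lt_of_le (by positivity) hN
  set a : ℝ := ∑ v, p v * f v with ha
  have hmean : ∀ m, ∫ w, f (X m w) ∂P = a := fun m => by
    rw [integral_comp_of_finite P (hX m)]
    simp only [hp, ha]
  have hmeas : ∀ m, Measurable fun w => f (X m w) := fun m => (measurable_of_finite f).comp (hX m)
  have hsub : ∀ m, HasSubgaussianMGF (fun w => f (X m w) - a) ((‖R - -R‖₊ / 2) ^ 2) P := by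
    intro m
    rw [← hmean m]
    exact hasSubgaussianMGF_of_mem_Icc (hmeas m).aemeasurable
      (Filter.Eventually.of_forall fun w => abs_le.mp (hf (X m w)))
  have hpar : ((∑ _m : Fin N, (‖R - -R‖₊ / 2) ^ 2 : NNReal) : ℝ) = N * R ^ 2 := by
    have : |R + R| / 2 = R := by
      rw [abs_of_pos (by linarith)]; ring
    simp [this]
  have hexp : Real.exp (-(N * η) ^ 2 / (2 * (N * R ^ 2))) ≤ δ / 2 := by
    rw [← Real.exp_log (by positivity : 0 < δ / 2), Real.exp_le_exp]
    have h1 : Real.log (δ / 2) = -Real.log (2 / δ) := by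
      rw [← Real.log_inv, inv_div]
    rw [h1, div_le_iff₀ (by positivity)]
    rw [div_le_iff₀ (by positivity)] at hN
    nlinarith
  have hg : Measurable fun v : α => f v - a := measurable_of_finite _
  have up := HasSubgaussianMGF.measure_sum_ge_le_of_iIndepFun (s := Finset.univ)
    (hind.comp (fun _ v => f v - a) fun _ => hg) (fun m _ => hsub m)
    (mul_nonneg hN0.le hη.le)
  have dn := HasSubgaussianMGF.measure_sum_ge_le_of_iIndepFun (s := Finset.univ)
    (hind.comp (fun _ v => -(f v - a)) fun _ => hg.neg) (fun m _ => (hsub m).neg)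
    (mul_nonneg hN0.le hη.le)
  rw [hpar] at up dn
  replace up := up.trans hexp
  replace dn := dn.trans hexp
  have hcompl : ({w | |a - 1 / N * ∑ m, f (X m w)| ≤ η}ᶜ : Set Ω)
      ⊆ {w | N * η ≤ ∑ m, ((fun v => f v - a) ∘ X m) w}
        ∪ {w | N * η ≤ ∑ m, ((fun v => -(f v - a)) ∘ X m) w} := by
    intro w hw
    simp only [Set.mem_compl_iff, Set.mem_ofPred_eq, not_le] at hw
    simp only [Set.mem_union, Set.mem_ofPred_eq, Function.comp_apply, Finset.sum_neg_distrib,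
      Finset.sum_sub_distrib, Finset.sum_const, Finset.card_univ, Fintype.card_fin, nsmul_eq_mul]
    have h2 : a - 1 / N * ∑ m, f (X m w) = -(∑ m, f (X m w) - N * a) / N := by
      field_simp
      ring
    rw [h2, lt_abs, ← neg_div, lt_div_iff₀ hN0, lt_div_iff₀ hN0] at hw
    rcases hw with h | h
    · right; linarith
    · left; linarith
  have hms : MeasurableSet {w | |a - 1 / N * ∑ m, f (X m w)| ≤ η} := by
    refine measurableSet_le ?_ measurable_const
    have : Measurable fun w => ∑ m, f (X m w) := Finset.measurable_sum _ fun m _ => hmeas m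
    fun_prop
  have h3 := (measureReal_mono hcompl (μ := P)).trans (measureReal_union_le _ _)
  have h4 := probReal_compl_eq_one_sub hms (μ := P)
  linarith

namespace OpenSystem

variable {n J r : ℕ} (Q : OpenSystem n J r)

/-! ### Mean and size of the outcomes -/

/-- If the normalisation vanishes, all coefficients vanish too, so the default value of division by
zero does no harm. -/
theorem stepNorm_mul_stepProb (δt : ℝ) (k : ℕ) (ℓ : Fin n → Fin 16) :
    |Q.stepCoeff δt k ℓ| / Q.stepNorm δt k * (Q.stepNorm δt k * Real.sign (Q.stepCoeff δt k ℓ))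
      = Q.stepCoeff δt k ℓ := by
  have h1 : |Q.stepCoeff δt k ℓ| ≤ Q.stepNorm δt k :=
    Finset.single_le_sum (f := fun ℓ => |Q.stepCoeff δt k ℓ|) (fun _ _ => abs_nonneg _)
      (Finset.mem_univ ℓ)
  by_cases h : Q.stepNorm δt k = 0
  · rw [h] at h1 ⊢
    have := abs_nonpos_iff.mp h1
    simp [this]
  · rw [← mul_assoc, div_mul_cancel₀ _ h]
    rcases lt_trichotomy (Q.stepCoeff δt k ℓ) 0 with h2 | h2 | h2
    · rw [abs_of_neg h2, Real.sign_of_neg h2]; ring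
    · simp [h2]
    · rw [abs_of_pos h2, Real.sign_of_pos h2, mul_one]

theorem pathProb_mul_outcome (δt : ℝ) (ρ₀ O : QMat n) {M : ℕ} (ℓ : Fin M → Fin n → Fin 16) :
    Q.pathProb δt ℓ * Q.outcome δt ρ₀ O ℓ
      = (∏ k : Fin M, Q.stepCoeff δt k (ℓ k)) * (O * Q.trajectory δt ρ₀ ℓ).trace.re := by
  rw [outcome, pathProb, totalNorm, pathSign, ← mul_assoc, ← Finset.prod_mul_distrib,
    ← Finset.prod_mul_distrib]
  simp only [stepNorm_mul_stepProb]

/-- Unbiasedness at the level of states: by linearity the sum over the last index rebuilds the last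
recovery operator, and the remaining sum is the induction hypothesis. -/
theorem sum_stepCoeff_smul_trajectory (δt : ℝ) (ρ₀ : QMat n) (M : ℕ) :
    ∑ ℓ : Fin M → Fin n → Fin 16, (∏ k : Fin M, (Q.stepCoeff δt k (ℓ k) : ℂ)) •
      Q.trajectory δt ρ₀ ℓ = Q.mitigatedEvolution δt M ρ₀ := by
  induction M with
  | zero => simp [trajectory, mitigatedEvolution]
  | succ M ih =>
    have hrec : Q.recovery (M * δt) δt
        = ∑ ℓ, (Q.stepCoeff δt M ℓ : ℂ) • basisOp ℓ :=
      (Q.isHermitianPreserving_recovery (M * δt) δt).isQuasiProb_quasiProb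
    rw [← Equiv.sum_comp (Fin.snocEquiv fun _ : Fin (M + 1) => Fin n → Fin 16)
      (fun ℓ => (∏ k : Fin (M + 1), (Q.stepCoeff δt k (ℓ k) : ℂ)) • Q.trajectory δt ρ₀ ℓ),
      Fintype.sum_prod_type]
    change _ = Q.recovery (M * δt) δt (Q.noisyEvolution ((M + 1 : ℕ) * δt) (M * δt)
      (Q.mitigatedEvolution δt M ρ₀))
    rw [← ih, hrec]
    simp only [sum_apply, smul_apply, map_sum, map_smul]
    rw [Finset.sum_comm]
    refine Finset.sum_congr rfl fun v _ => ?_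
    rw [Finset.smul_sum]
    refine Finset.sum_congr rfl fun x _ => ?_
    have h1 : Q.trajectory δt ρ₀ ((Fin.snocEquiv fun _ : Fin (M + 1) => Fin n → Fin 16) (x, v))
        = basisOp x (Q.noisyEvolution ((M + 1 : ℕ) * δt) (M * δt) (Q.trajectory δt ρ₀ v)) := by
      simp [trajectory, Fin.snocEquiv]
    rw [h1, Fin.prod_univ_castSucc, smul_smul]
    simp [Fin.snocEquiv]

theorem sum_pathProb_mul_outcome (δt : ℝ) (ρ₀ O : QMat n) (M : ℕ) :
    ∑ ℓ : Fin M → Fin n → Fin 16, Q.pathProb δt ℓ * Q.outcome δt ρ₀ O ℓ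
      = (O * Q.mitigatedEvolution δt M ρ₀).trace.re := by
  simp only [pathProb_mul_outcome, ← sum_stepCoeff_smul_trajectory, Finset.mul_sum,
    Matrix.trace_sum, Complex.re_sum]
  refine Finset.sum_congr rfl fun ℓ _ => ?_
  rw [mul_smul_comm, Matrix.trace_smul, smul_eq_mul, ← Complex.ofReal_prod, Complex.re_ofReal_mul]

/-- The last step is moved onto the observable, hence the induction for all `X`. Basis operations
contract there and a noisy step costs 1 + 2Lδt; no positivity of the noisy evolution is used. -/
theorem norm_trace_mul_trajectory_le (hH : Q.H.IsHermitian) {L δt : ℝ} (hδt : 0 ≤ δt)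
    (hL : ∀ τ, 0 ≤ τ → ‖heisenbergDual (Q.noiseGenerator τ)‖ ≤ L) (hLd : L * δt ≤ 1 / 2)
    {ρ₀ : QMat n} (hρ : IsDensity ρ₀) {M : ℕ} (ℓ : Fin M → Fin n → Fin 16) (X : QMat n) :
    ‖(X * Q.trajectory δt ρ₀ ℓ).trace‖ ≤ (1 + 2 * (L * δt)) ^ M * ‖X‖ := by
  induction M generalizing X with
  | zero => simpa [trajectory] using hρ.norm_trace_mul_le X
  | succ M ih =>
    have hs : 0 ≤ (M : ℝ) * δt := by positivity
    have hM : ((M + 1 : ℕ) : ℝ) * δt = M * δt + δt := by push_cast; ring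
    have h1 := Q.norm_heisenbergDual_noisyEvolution_le hH
      (Q.noisyEvolution_spec (M * δt)) hs hδt hL hLd (t := M * δt + δt) ⟨by linarith, le_rfl⟩
    rw [trajectory, ← trace_heisenbergDual_mul, ← trace_heisenbergDual_mul, hM]
    refine (ih _ _).trans ?_
    have h0 : 0 ≤ L * δt := mul_nonneg ((norm_nonneg _).trans (hL 0 le_rfl)) hδt
    rw [pow_succ, mul_assoc]
    refine mul_le_mul_of_nonneg_left ?_ (by positivity)
    refine (ContinuousLinearMap.le_opNorm _ _).trans
      (mul_le_mul h1 ?_ (norm_nonneg _) (by linarith))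
    refine (ContinuousLinearMap.le_opNorm _ _).trans
      (mul_le_of_le_one_left (norm_nonneg _) (norm_heisenbergDual_basisOp_le _))

theorem abs_pathSign_le (δt : ℝ) {M : ℕ} (ℓ : Fin M → Fin n → Fin 16) :
    |Q.pathSign δt ℓ| ≤ 1 := by
  rw [pathSign, Finset.abs_prod]
  refine Finset.prod_le_one (fun _ _ => abs_nonneg _) fun k _ => ?_
  rcases Real.sign_apply_eq (Q.stepCoeff δt k (ℓ k)) with h | h | h <;> simp [h]

end OpenSystem

/-! ### Uniform bounds on the outcomes and on the bias. -/

namespace OpenSystem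

variable {n J r : ℕ} (Q : OpenSystem n J r)

/-- In the exponent, 2D comes from the normalisation constants and 4 from the growth of the
trajectory. -/
theorem abs_outcome_le (hH : Q.H.IsHermitian) (hS : ∀ j, ‖Q.S j‖ ≤ 1)
    (hω : ∀ μ, 0 < (Q.ω μ).im) {D : ℝ} (hD0 : 0 ≤ D)
    (hD : ∀ Φ : Superop n, IsHermitianPreserving (1 - Φ) →
      ∑ ℓ, |quasiProb (1 - Φ) ℓ| ≤ 1 + D * ‖Φ‖)
    {δt : ℝ} (hδt : 0 ≤ δt) (hsmall : 2 * (Q.lam ^ 2 * Q.G₁) * δt ≤ 1 / 2)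
    {ρ₀ : QMat n} (hρ : IsDensity ρ₀) (O : QMat n) {M : ℕ} (ℓ : Fin M → Fin n → Fin 16) :
    |Q.outcome δt ρ₀ O ℓ|
      ≤ ‖O‖ * Real.exp ((2 * D + 4) * (Q.lam ^ 2 * Q.G₁ * (M * δt))) := by
  have hL : ∀ τ, 0 ≤ τ → ‖heisenbergDual (Q.noiseGenerator τ)‖ ≤ 2 * (Q.lam ^ 2 * Q.G₁) :=
    fun τ hτ => Q.norm_heisenbergDual_noiseGenerator_le hH hS hω hτ
  set Λ := Q.lam ^ 2 * Q.G₁ with hΛ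
  have hΛ0 : 0 ≤ Λ := by linarith [(norm_nonneg _).trans (hL 0 le_rfl)]
  have hstep : ∀ k : ℕ, Q.stepNorm δt k ≤ Real.exp (D * (δt * (2 * Λ))) := by
    intro k
    have h1 := Q.norm_noiseGenerator_le hH hS hω (t := k * δt + δt) (by positivity)
    have h2 := hD ((δt : ℂ) • Q.noiseGenerator (k * δt + δt))
      (Q.isHermitianPreserving_recovery (k * δt) δt)
    rw [norm_smul, Complex.norm_real, Real.norm_of_nonneg hδt] at h2
    refine h2.trans (le_trans ?_ (Real.add_one_le_exp _))
    rw [add_comm]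
    gcongr
  have hstep0 : ∀ k : ℕ, 0 ≤ Q.stepNorm δt k := fun k =>
    Finset.sum_nonneg fun _ _ => abs_nonneg _
  have htot : |Q.totalNorm δt M| ≤ Real.exp (D * (δt * (2 * Λ))) ^ M := by
    rw [totalNorm, Finset.abs_prod]
    refine (Finset.prod_le_prod (fun _ _ => abs_nonneg _) fun k _ => ?_).trans
      (by simp : ∏ _k : Fin M, Real.exp (D * (δt * (2 * Λ))) ≤ _)
    rw [abs_of_nonneg (hstep0 _)]
    exact hstep k
  have htraj : |(O * Q.trajectory δt ρ₀ ℓ).trace.re|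
      ≤ Real.exp (2 * (2 * Λ * δt)) ^ M * ‖O‖ := by
    refine (Complex.abs_re_le_norm _).trans
      ((Q.norm_trace_mul_trajectory_le hH hδt hL hsmall hρ ℓ O).trans ?_)
    gcongr
    linarith [Real.add_one_le_exp (2 * (2 * Λ * δt))]
  rw [outcome, abs_mul, abs_mul]
  calc _ ≤ Real.exp (D * (δt * (2 * Λ))) ^ M * 1 * (Real.exp (2 * (2 * Λ * δt)) ^ M * ‖O‖) := by
        gcongr
        exact Q.abs_pathSign_le δt ℓ
    _ = _ := by
        rw [← Real.exp_nat_mul, ← Real.exp_nat_mul, mul_one, ← mul_assoc, ← Real.exp_add,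
          mul_comm]
        congr 2
        ring

/-- From 1 - exp(-θ) ≤ θ ≤ Im ω; the factor 4 is the ratio of the prefactors 2 and 1/2. -/
theorem G₁_le (hω : ∀ μ, 0 < (Q.ω μ).im) :
    Q.G₁ ≤ 4 * (Q.G₂ * (1 / (1 - Real.exp (-Q.θ)))) := by
  have h : ∀ μ, 1 / (Q.ω μ).im ≤ 1 / (1 - Real.exp (-Q.θ)) := by
    intro μ
    have hle : Q.θ ≤ (Q.ω μ).im := ciInf_le (Set.finite_range _).bddBelow μ
    have hpos : 0 < Q.θ := by
      have : Nonempty (Fin r) := ⟨μ⟩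
      obtain ⟨ν, hν⟩ := exists_eq_ciInf_of_finite (f := fun μ => (Q.ω μ).im)
      rw [θ, ← hν]
      exact hω ν
    have h1 : Real.exp (-Q.θ) < 1 := by simpa using hpos
    have h2 := Real.add_one_le_exp (-Q.θ)
    exact one_div_le_one_div_of_le (by linarith) (by linarith)
  unfold G₁ G₂
  calc _ ≤ 2 * ∑ μ, (∑ j, ‖Q.g j μ‖) ^ 2 * (1 / (1 - Real.exp (-Q.θ))) :=
        mul_le_mul_of_nonneg_left (Finset.sum_le_sum fun μ _ =>
          mul_le_mul_of_nonneg_left (h μ) (sq_nonneg _)) zero_le_two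
    _ = _ := by rw [← Finset.sum_mul]; ring

theorem G₁_nonneg (hω : ∀ μ, 0 < (Q.ω μ).im) : 0 ≤ Q.G₁ :=
  mul_nonneg zero_le_two (Finset.sum_nonneg fun μ _ =>
    mul_nonneg (sq_nonneg _) (one_div_nonneg.mpr (hω μ).le))

/-- The bias of the mitigated evolution. -/
theorem abs_trace_freeEvolution_sub_mitigatedEvolution_le (hH : Q.H.IsHermitian)
    (hS : ∀ j, ‖Q.S j‖ ≤ 1) (hω : ∀ μ, 0 < (Q.ω μ).im) {δt B : ℝ} (hδt : 0 ≤ δt)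
    (hsmall : 2 * (Q.lam ^ 2 * Q.G₁) * δt ≤ 1 / 2) {ρ₀ : QMat n} (hρ : IsDensity ρ₀)
    (O : QMat n) (M : ℕ) (hB1 : B ≤ 1)
    (hB : 16 * (M * δt * δt * (Q.lam ^ 2 * Q.G₁) ^ 2)
      + 8 * (δt * (M * δt) * ‖Q.H‖ * (Q.lam ^ 2 * Q.G₁)) + 2 * (δt * (Q.lam ^ 2 * Q.G₁)) ≤ B) :
    |(O * Q.freeEvolution (M * δt) ρ₀).trace.re
      - (O * Q.mitigatedEvolution δt M ρ₀).trace.re| ≤ 2 * B * ‖O‖ := by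
  have hL : ∀ τ, 0 ≤ τ → ‖heisenbergDual (Q.noiseGenerator τ)‖ ≤ 2 * (Q.lam ^ 2 * Q.G₁) :=
    fun τ hτ => Q.norm_heisenbergDual_noiseGenerator_le hH hS hω hτ
  have hΛ0 : 0 ≤ Q.lam ^ 2 * Q.G₁ := mul_nonneg (sq_nonneg _) (Q.G₁_nonneg hω)
  have h1 := Q.norm_heisenbergDual_mitigatedEvolution_sub_le hH hS hδt hL hsmall M
  have h2 := mul_le_mul_of_nonneg_left (Q.noiseMass_zero_le hω (M * δt)) hδt
  generalize Q.lam ^ 2 * Q.G₁ = Λ at *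
  have hB0 : 0 ≤ B := le_trans (by positivity) hB
  -- With L = 2Λ the step errors give 16 and 8, and the total noise mass is at most 2Λ.
  have h3 : M * δt * (4 * (2 * Λ) ^ 2 * δt + 4 * (2 * Λ) * δt * ‖Q.H‖)
      + δt * Q.noiseMass 0 (M * δt) ≤ B := by
    refine le_trans ?_ hB
    linarith
  have h4 : Real.exp B - 1 ≤ 2 * B := by
    have h5 := Real.abs_exp_sub_one_le (x := B) (by rwa [abs_of_nonneg hB0])
    rw [abs_of_nonneg hB0] at h5
    exact (le_abs_self _).trans h5
  have h6 : ‖heisenbergDual (Q.mitigatedEvolution δt M)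
      - heisenbergDual (Q.freeEvolution (M * δt))‖ ≤ 2 * B :=
    (h1.trans (sub_le_sub_right (Real.exp_le_exp.mpr h3) 1)).trans h4
  rw [← Complex.sub_re, ← trace_heisenbergDual_mul, ← trace_heisenbergDual_mul,
    ← Matrix.trace_sub, ← sub_mul, ← sub_apply]
  rw [norm_sub_rev] at h6
  exact ((Complex.abs_re_le_norm _).trans (hρ.norm_trace_mul_le _)).trans
    ((ContinuousLinearMap.le_opNorm _ _).trans (mul_le_mul_of_nonneg_right h6 (norm_nonneg _)))

end OpenSystem

/-! ### Choice of the constants and conclusion. -/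

theorem mainTheorem3 (K b : ℝ) :
    ∃ c : ℝ, 0 < c ∧ ∃ C : ℝ, 0 < C ∧ ∀ n : ℕ, ∃ κ : ℝ, 0 < κ ∧
      ∀ (J r : ℕ) (Q : OpenSystem n J r) (ρ₀ O : QMat n) (M : ℕ) (T δt ε δ : ℝ),
        Q.H.IsHermitian → (∀ j, (Q.S j).IsHermitian) → (∀ j, ‖Q.S j‖ ≤ 1) →
        (∀ μ, 0 < (Q.ω μ).im) →
        IsDensity ρ₀ → O.IsHermitian → ‖O‖ ≤ b →
        0 < δt → T = M * δt →
        0 < ε → ε ≤ 1 → 0 < δ → δ ≤ 1 →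
        (Q.lam ^ 2 * Q.G₁ ≤ K * ‖Q.H‖ ∨ Q.lam ^ 2 * T * Q.G₁ ≤ K) →
        δt * (Q.lam ^ 2 * (T * ‖Q.H‖ * Q.G₁ + Q.G₂ * (1 / (1 - Real.exp (-Q.θ))))) ≤ c * ε →
        ∀ N : ℕ, C * (Real.log (2 / δ) * Real.exp (κ * (Q.lam ^ 2 * T * Q.G₁)) / ε ^ 2) ≤ N →
        ∀ {Ω : Type*} [MeasurableSpace Ω] (P : Measure Ω) [IsProbabilityMeasure P]
          (ℓ : Fin N → Ω → Fin M → Fin n → Fin 16),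
          (∀ m, Measurable (ℓ m)) → iIndepFun ℓ P →
          (∀ m v, P.real {w | ℓ m w = v} = Q.pathProb δt v) →
          1 - δ ≤ P.real {w | |(O * Q.freeEvolution T ρ₀).trace.re
            - (1 / N) * ∑ m, Q.outcome δt ρ₀ O (ℓ m w)| ≤ ε} := by
  -- In units of cε, the bias terms with prefactors 16, 8 and 2 are at most 64|K|, 8 and 8.
  set A : ℝ := 64 * |K| + 16 with hA
  have hA16 : 16 ≤ A := by linarith [abs_nonneg K]
  have hb1 : 1 ≤ |b| + 1 := by linarith [abs_nonneg b]
  -- This `c` keeps the bias below ε/2; 8 = 2/(1/2)² comes from Hoeffding with tolerance ε/2. The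
  -- added 1 keeps denominators positive when `b` is 0.
  refine ⟨1 / (A * (4 * (|b| + 1))), by positivity, 8 * (|b| + 1) ^ 2, by positivity, fun n => ?_⟩
  obtain ⟨D, hD0, hD⟩ := exists_sum_abs_quasiProb_one_sub_le n
  -- Twice the exponent of the outcome bound, since Hoeffding uses its square.
  refine ⟨2 * (2 * D + 4), by positivity, ?_⟩
  intro J r Q ρ₀ O M T δt ε δ hH hS hS1 hω hρ hO hOb hδt hT hε hε1 hδ hδ1 hK hstep N hN
    Ω _ P _ ℓ hmeas hind hlaw
  subst hT
  have hΛ0 : 0 ≤ Q.lam ^ 2 * Q.G₁ := mul_nonneg (sq_nonneg _) (Q.G₁_nonneg hω)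
  have hG : Q.lam ^ 2 * Q.G₁ ≤ 4 * (Q.lam ^ 2 * (Q.G₂ * (1 / (1 - Real.exp (-Q.θ))))) := by
    linarith [mul_le_mul_of_nonneg_left (Q.G₁_le hω) (sq_nonneg Q.lam)]
  have hc : A * (1 / (A * (4 * (|b| + 1))) * ε) = ε / (4 * (|b| + 1)) := by
    field_simp
  set c : ℝ := 1 / (A * (4 * (|b| + 1)))
  have hG0 : 0 ≤ Q.lam ^ 2 * (Q.G₂ * (1 / (1 - Real.exp (-Q.θ)))) := by linarith
  have hexp : Q.lam ^ 2 * (M * δt) * Q.G₁ = Q.lam ^ 2 * Q.G₁ * (M * δt) := by ring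
  have hstep' : δt * (M * δt) * ‖Q.H‖ * (Q.lam ^ 2 * Q.G₁)
      + δt * (Q.lam ^ 2 * (Q.G₂ * (1 / (1 - Real.exp (-Q.θ))))) ≤ c * ε := by
    refine le_trans (le_of_eq ?_) hstep
    ring
  rw [hexp] at hK hN
  generalize Q.lam ^ 2 * (Q.G₂ * (1 / (1 - Real.exp (-Q.θ)))) = Y at *
  have hM0 : 0 ≤ (M : ℝ) * δt := by positivity
  obtain ⟨Λ, hΛ⟩ : ∃ Λ, Λ = Q.lam ^ 2 * Q.G₁ := ⟨_, rfl⟩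
  rw [← hΛ] at hΛ0 hK hstep' hN hG
  have hYΛ : δt * Λ ≤ 4 * (δt * Y) := by
    have := mul_le_mul_of_nonneg_left hG hδt.le
    linarith
  have hp1 : 0 ≤ δt * (M * δt) * ‖Q.H‖ * Λ := by positivity
  have hp2 : 0 ≤ δt * Y := by positivity
  have hx : δt * Λ ≤ 4 * (c * ε) := by linarith
  have hz : δt * (M * δt) * ‖Q.H‖ * Λ ≤ c * ε := by linarith
  have hcε : 0 ≤ c * ε := by linarith
  -- Weak coupling trades one factor Λ for |K|‖H‖, reducing to the Hamiltonian term. Short time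
  -- trades ΛT for |K|, leaving δtΛ ≤ 4cε.
  have hquad : M * δt * δt * Λ ^ 2 ≤ 4 * |K| * (c * ε) := by
    rcases hK with h | h
    · have h1 : Λ ≤ |K| * ‖Q.H‖ :=
        h.trans (mul_le_mul_of_nonneg_right (le_abs_self K) (norm_nonneg _))
      have h2 : M * δt * δt * Λ ^ 2 ≤ |K| * (δt * (M * δt) * ‖Q.H‖ * Λ) := by
        calc _ = (M * δt * δt * Λ) * Λ := by ring
          _ ≤ (M * δt * δt * Λ) * (|K| * ‖Q.H‖) := by gcongr
          _ = _ := by ring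
      have h3 := mul_le_mul_of_nonneg_left hz (abs_nonneg K)
      nlinarith [mul_nonneg (abs_nonneg K) hcε]
    · have h1 : Λ * (M * δt) ≤ |K| := h.trans (le_abs_self K)
      calc _ = (Λ * (M * δt)) * (δt * Λ) := by ring
        _ ≤ |K| * (4 * (c * ε)) := by gcongr
        _ = _ := by ring
  have hB : 16 * (M * δt * δt * Λ ^ 2) + 8 * (δt * (M * δt) * ‖Q.H‖ * Λ) + 2 * (δt * Λ)
      ≤ ε / (4 * (|b| + 1)) := by
    rw [← hc, hA]
    linarith
  have hB1 : ε / (4 * (|b| + 1)) ≤ 1 / 4 := by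
    rw [div_le_iff₀ (by positivity)]
    linarith
  have hsmall : 2 * Λ * δt ≤ 1 / 2 := by
    have : 0 ≤ 16 * (M * δt * δt * Λ ^ 2) := by positivity
    linarith
  rw [hΛ] at hB hsmall
  have hbias := Q.abs_trace_freeEvolution_sub_mitigatedEvolution_le hH hS1 hω hδt.le hsmall hρ O M
    (by linarith) hB
  have hbias' : 2 * (ε / (4 * (|b| + 1))) * ‖O‖ ≤ ε / 2 := by
    have h1 : ‖O‖ ≤ |b| + 1 := by linarith [le_abs_self b]
    calc _ ≤ 2 * (ε / (4 * (|b| + 1))) * (|b| + 1) := by gcongr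
      _ = _ := by field_simp; norm_num
  have hout : ∀ v : Fin M → Fin n → Fin 16, |Q.outcome δt ρ₀ O v|
      ≤ (|b| + 1) * Real.exp ((2 * D + 4) * (Λ * (M * δt))) := by
    intro v
    rw [hΛ]
    refine (Q.abs_outcome_le hH hS1 hω hD0 hD hδt.le hsmall hρ O v).trans ?_
    gcongr
    linarith [le_abs_self b]
  have hNum : 2 * ((|b| + 1) * Real.exp ((2 * D + 4) * (Λ * (M * δt)))) ^ 2
      * Real.log (2 / δ) / (ε / 2) ^ 2 ≤ N := by
    refine le_trans (le_of_eq ?_) hN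
    have : Real.exp (2 * (2 * D + 4) * (Λ * (M * δt)))
        = Real.exp ((2 * D + 4) * (Λ * (M * δt))) ^ 2 := by
      rw [← Real.exp_nat_mul]
      congr 1
      push_cast
      ring
    rw [this]
    field_simp
    ring
  have hhoeff := measureReal_abs_mean_sub_le P ℓ hmeas hind (Q.outcome δt ρ₀ O) hlaw
    (by positivity) hout (half_pos hε) hδ hδ1 hNum
  rw [Q.sum_pathProb_mul_outcome] at hhoeff
  refine hhoeff.trans (measureReal_mono fun w hw => ?_)
  refine (abs_sub_le _ (O * Q.mitigatedEvolution δt M ρ₀).trace.re _).trans ?_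
  have hw' : |(O * Q.mitigatedEvolution δt M ρ₀).trace.re
      - 1 / N * ∑ m, Q.outcome δt ρ₀ O (ℓ m w)| ≤ ε / 2 := hw
  linarith
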